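/- **Setting.** Let $N\ge 2$ and let $2N$ items have unknown parameters $1>u_1\ge u_2\ge\dots\ge u_{2N}>0$ with all gaps $\Delta_{2k,2k+1}:=u_{2k}-u_{2k+1}>0$, $k\in[N-1]$ (so that the optimal matching is $\{1,2\},\{3,4\},\dots$). At each time $t$ a maximal matching $m_t$ of the items is sampled, and for each of its pairs $\{i,j\}$ one observes $X_{i,j,t}=u_iu_j+\varepsilon_{i,j,t}$, where the $\varepsilon_{i,j,t}$ are independent over unordered pairs $\{i,j\}$ and times $t$, zero-mean and sub-Gaussian with variance proxy $1/4$, i.e. $\mathbb E\,e^{x\varepsilon_{i,j,t}}\le e^{x^2/8}$ for all real $x$ (as for rewards in $[0,1]$). A matching is optimal if it maximizes $\sum_{\{i,j\}\in m}u_iu_j$ over the maximal matchings $m$. **Algorithm Matching-id, with parameter $\delta>0$.** It keeps an ordered partition of the items into clusters, initially the single cluster $[2N]$; an item is known to be better than those of all lower clusters. An item is *ranked* if its cluster is a singleton, or has two elements and an even number of items above it. Let $\mathcal S$ be the set of un-ranked items and $\mathcal B$ the set of items with fewer than $|\mathcal S|$ items in higher clusters (the candidates for the $|\mathcal S|$ best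 items). While $\mathcal S\ne\emptyset$, the following iteration is repeated. 1. Let $A=\mathcal B\cup\mathcal S$, with a best remaining item (one with fewest items in higher clusters) added if $|\mathcal B\cup\mathcal S|$ is odd. Sample $|A|-1$ maximal matchings that form a round-robin tournament on $A$ (every pair of items of $A$ is matched exactly once), completed arbitrarily by matchings of $[2N]\setminus A$. For each $i\in\mathcal S$ record its observations with partners in $\mathcal B$. 2. Put $\beta_l=\pi\sqrt{2N/(3\delta)}\,l$ and $k_l=\lceil 4^{l+1}\log\beta_l\rceil$ for $l\ge1$. If during the iteration the number of recorded observations of $i$ has reached a new level $k_l$ (take the largest such $l$), set $Q_\pm(i)=\hat x_i\pm\sqrt{\log(\beta_l)/k_l}$, where $\hat x_i$ is the mean of all observations recorded for $i$ so far; otherwise $Q_\pm(i)$ is unchanged. Initially $Q_\pm(i)=\pm\infty$. 3. A cluster is split between an upper part and the rest whenever $Q_-(v)>Q_+(w)$ for all $v$ in the upper part and all $w$ in the rest. When all items are ranked, the algorithm returns the matching that pairs the items of ranks $2k-1$ and $2k$, $k\in[N]$. Let $\tau_\delta$ be the number of maximal matchings sampled until then. **Notation.** For $k\in[N-1]$ let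 $\mu_{[2N]\setminus\{2k,2k+1\}}=\frac1{2N}\sum_{i\in[2N]\setminus\{2k,2k+1\}}u_i$, and let $\gamma_{\min}=\min_{k\in[N-1]}\mu_{[2N]\setminus\{2k,2k+1\}}\Delta_{2k,2k+1}$. **Theorem.** There is a universal constant $c>0$ with the following properties. (1) For every $N\ge2$ and every $u$ as above there is a constant $c_{\mathfrak p}$, depending only on $N$ and $u$, such that for every $\delta>0$, every noise as above and all arbitrary choices of the algorithm, with probability at least $1-\delta$ the algorithm returns the optimal matching with $$\tau_\delta\le \frac{c}{\gamma_{\min}^2}\log(1/\delta)+c_{\mathfrak p}.$$ (2) Suppose moreover that $s\in[2,N-1]$ satisfies $\Delta_{2s,2s+1}=\min_{k\in[N-1]}\Delta_{2k,2k+1}$ (the smallest gap is not between the two best pairs), let $h$ minimize $\mu_{[2N]\setminus\{2k,2k+1\}}\Delta_{2k,2k+1}$ over $k\in[N-1]\setminus\{s\}$, and put $$\alpha=\min\Big\{\frac12\,\frac{(u_1+u_2)\Delta_{2s,2s+1}}{\mu_{[2N]\setminus\{2h,2h+1\}}\Delta_{2h,2h+1}},\,1\Big\}.$$ If $\alpha<1$,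 then there is a constant $c_{\mathfrak p}$, depending only on $N,u,s,h$, such that for every $\delta>0$, every noise as above and all arbitrary choices of the algorithm, with probability at least $1-\delta$ the algorithm returns the optimal matching with $$\tau_\delta\le \frac{c}{(1-\alpha)^2(u_1^2+u_2^2)\Delta_{2s,2s+1}^2}\log(1/\delta)+c_{\mathfrak p}.$$ -/

import Mathlib

open MeasureTheory ProbabilityTheory
open scoped NNReal ENNReal

universe w

namespace MatchingId

noncomputable section

/-- The `2N` items. They are 0-based: item `i` here is item `i + 1` of the usual numbering. -/
abbrev Item (N : ℕ) : Type := Fin (2 * N)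

/-! ### Matchings -/

/-- A maximal matching of the `2N` items, given as the map sending an item to its partner. -/
def IsMaxMatching {N : ℕ} (m : Item N → Item N) : Prop :=
  (∀ i, m (m i) = i) ∧ ∀ i, m i ≠ i

/-- A maximal matching which maximizes the expected reward for the reward matrix `u uᵀ`
(in both sums every pair of the matching is counted twice). -/
def IsOptimalMatching {N : ℕ} (u : Item N → ℝ) (m : Item N → Item N) : Prop :=
  IsMaxMatching m ∧ ∀ m' : Item N → Item N, IsMaxMatching m' →
    ∑ i, u i * u (m' i) ≤ ∑ i, u i * u (m i)

/-! ### Problem parameters -/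

/-- Item `2k` in 1-based numbering, where `k = k₀ + 1 ∈ [N-1]`: the weaker item of pair `k`. -/
def upperItem {N : ℕ} (k : Fin (N - 1)) : Item N := ⟨2 * (k : ℕ) + 1, by omega⟩

/-- Item `2k+1` in 1-based numbering, where `k = k₀ + 1 ∈ [N-1]`: the stronger item of
pair `k+1`. -/
def lowerItem {N : ℕ} (k : Fin (N - 1)) : Item N := ⟨2 * (k : ℕ) + 2, by omega⟩

/-- The gap `Δ_{2k,2k+1} = u_{2k} - u_{2k+1}`. -/
def gap {N : ℕ} (u : Item N → ℝ) (k : Fin (N - 1)) : ℝ := u (upperItem k) - u (lowerItem k)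

/-- `μ_{[2N] ∖ {2k,2k+1}} = (1 / 2N) ∑_{i ∉ {2k, 2k+1}} u_i`. -/
def muWithout {N : ℕ} (u : Item N → ℝ) (k : Fin (N - 1)) : ℝ :=
  1 / (2 * (N : ℝ)) * ∑ i ∈ (Finset.univ : Finset (Item N)) \ {upperItem k, lowerItem k}, u i

/-- `γ_min`, the minimum over `k ∈ [N-1]` of the effective gaps `μ_{[2N]∖{2k,2k+1}} Δ_{2k,2k+1}`. -/
def gammaMin {N : ℕ} (u : Item N → ℝ) : ℝ := ⨅ k : Fin (N - 1), muWithout u k * gap u k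

/-- `α = min {(1/2) (u₁+u₂) Δ_{2s,2s+1} / (μ_{[2N]∖{2h,2h+1}} Δ_{2h,2h+1}), 1}`,
with `u₁, u₂` the two largest parameters. -/
def alpha {N : ℕ} (u : Item N → ℝ) (u₁ u₂ : ℝ) (s h : Fin (N - 1)) : ℝ :=
  min (1 / 2 * ((u₁ + u₂) * gap u s / (muWithout u h * gap u h))) 1

/-! ### Noise model -/

/-- Independent, zero-mean sub-Gaussian noise, one variable for every unordered pair of items and
every time. The variance proxy is `1/4`, i.e. `𝔼 exp (t ε) ≤ exp (t² / 8)` for all `t`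
(this covers rewards with values in `[0, 1]`, e.g. Bernoulli rewards). -/
structure IsNoise {N : ℕ} {Ω : Type*} [MeasurableSpace Ω] (μ : Measure Ω)
    (ε : Sym2 (Item N) → ℕ → Ω → ℝ) : Prop where
  measurable : ∀ e t, Measurable (ε e t)
  indep : iIndepFun (fun p : Sym2 (Item N) × ℕ => ε p.1 p.2) μ
  mean_zero : ∀ e t, ∫ ω, ε e t ω ∂μ = 0
  subgaussian : ∀ e t, HasSubgaussianMGF (ε e t) (1 / 4 : ℝ≥0) μ

/-- The observation `X_{i,j,t} = u_i u_j + ε_{i,j,t}`. -/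
def observation {N : ℕ} {Ω : Type*} (u : Item N → ℝ) (ε : Sym2 (Item N) → ℕ → Ω → ℝ) (ω : Ω)
    (i j : Item N) (t : ℕ) : ℝ :=
  u i * u j + ε s(i, j) t ω

/-! ### The algorithm -/

/-- `β_l = π √(2N / (3δ)) l`. -/
def beta (N : ℕ) (δ : ℝ) (l : ℕ) : ℝ := Real.pi * Real.sqrt (2 * (N : ℝ) / (3 * δ)) * (l : ℝ)

/-- `k_l = ⌈4^(l+1) log β_l⌉`. -/
def kLevel (N : ℕ) (δ : ℝ) (l : ℕ) : ℕ := ⌈(4 : ℝ) ^ (l + 1) * Real.log (beta N δ l)⌉₊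

/-- The largest `l` with `k_l ≤ c`, or `0` if `c < k_1`. -/
def epoch (N : ℕ) (δ : ℝ) (c : ℕ) : ℕ := Nat.findGreatest (fun l => kLevel N δ l ≤ c) c

/-- The arbitrary choices of the algorithm. -/
structure Choices (N : ℕ) where
  /-- `matching A 0, …, matching A (|A| - 2)` are the maximal matchings sampled in an iteration
  with the even set `A`: a round-robin tournament on `A`, completed by an arbitrary matching of
  the remaining items. -/
  matching : Finset (Item N) → ℕ → Item N → Item N
  isMaxMatching : ∀ A : Finset (Item N), Even A.card → ∀ r < A.card - 1,
    IsMaxMatching (matching A r)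
  mapsTo : ∀ A : Finset (Item N), Even A.card → ∀ r < A.card - 1, ∀ i ∈ A, matching A r i ∈ A
  roundRobin : ∀ A : Finset (Item N), Even A.card → ∀ i ∈ A, ∀ j ∈ A, i ≠ j →
    ∃! r : ℕ, r < A.card - 1 ∧ matching A r i = j
  /-- A best item of a nonempty set, for the order in which an item is better if fewer items are
  known to be above it. -/
  best : (Item N → ℕ) → Finset (Item N) → Item N
  best_mem : ∀ (level : Item N → ℕ) (R : Finset (Item N)), R.Nonempty → best level R ∈ R
  best_le : ∀ (level : Item N → ℕ) (R : Finset (Item N)), ∀ j ∈ R,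
    level (best level R) ≤ level j

/-- The state of the algorithm between two iterations of its main loop. -/
structure State (N : ℕ) where
  /-- number of maximal matchings sampled so far -/
  time : ℕ
  /-- `total i = ∑_j X(i,j)`, the sum of the recorded observations of item `i` -/
  total : Item N → ℝ
  /-- `count i = ∑_j C(i,j)`, the number of the recorded observations of item `i` -/
  count : Item N → ℕ
  /-- lower confidence bound `Q₋` -/
  lo : Item N → EReal
  /-- upper confidence bound `Q₊` -/
  hi : Item N → EReal
  /-- `above i` is the set of the items that are known to be better than item `i` -/
  above : Item N → Finset (Item N)

/-- The initial state: nothing sampled, nothing known. -/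
def State.init (N : ℕ) : State N where
  time := 0
  total := fun _ => 0
  count := fun _ => 0
  lo := fun _ => ⊥
  hi := fun _ => ⊤
  above := fun _ => ∅

namespace State

variable {N : ℕ}

/-- The number of items known to be better than `i`, i.e. the best rank (counted from 0) that
item `i` can still have. -/
def level (st : State N) (i : Item N) : ℕ := (st.above i).card

/-- The cluster of item `i`: the items that are not yet ordered relative to `i`. Clusters form an
ordered partition of the items. -/
def cluster (st : State N) (i : Item N) : Finset (Item N) := {j | st.above j = st.above i}

/-- Item `i` is ranked if it is alone in its cluster, or if its cluster consists of it and one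
other item which is its optimal partner whatever their relative order. -/
def Ranked (st : State N) (i : Item N) : Prop :=
  (st.cluster i).card = 1 ∨ ((st.cluster i).card = 2 ∧ Even (st.level i))

open Classical in
/-- The set `S` of the un-ranked items. -/
def unranked (st : State N) : Finset (Item N) := {i | ¬ st.Ranked i}

/-- The set `B` of the items that are still potentially among the `|S|` best items. -/
def candidates (st : State N) : Finset (Item N) := {i | st.level i < st.unranked.card}

open Classical in
/-- The set of the items of the round-robin tournament: `B ∪ S`, with the best remaining item
added if the cardinality is odd. -/
def active (st : State N) (ch : Choices N) : Finset (Item N) :=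
  if Even (st.candidates ∪ st.unranked).card then st.candidates ∪ st.unranked
  else insert (ch.best st.level (st.candidates ∪ st.unranked)ᶜ) (st.candidates ∪ st.unranked)

/-- Number of matchings sampled in one iteration. -/
def rounds (st : State N) (ch : Choices N) : ℕ := (st.active ch).card - 1

/-- The partner of item `i` in the `r`-th matching of the iteration. -/
def partner (st : State N) (ch : Choices N) (r : ℕ) (i : Item N) : Item N :=
  ch.matching (st.active ch) r i

/-- The rounds of the iteration whose observation is recorded for item `i`: item `i` is un-ranked
and its partner is a candidate. -/
def recorded (st : State N) (ch : Choices N) (i : Item N) : Finset ℕ :=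
  {r ∈ Finset.range (st.rounds ch) | i ∈ st.unranked ∧ st.partner ch r i ∈ st.candidates}

/-- The sums of observations after the iteration; `x i j t` is the observation of the pair
`(i, j)` at time `t`. -/
def newTotal (st : State N) (ch : Choices N) (x : Item N → Item N → ℕ → ℝ) (i : Item N) : ℝ :=
  st.total i + ∑ r ∈ st.recorded ch i, x i (st.partner ch r i) (st.time + r)

/-- The numbers of observations after the iteration. -/
def newCount (st : State N) (ch : Choices N) (i : Item N) : ℕ :=
  st.count i + (st.recorded ch i).card

/-- The confidence interval of item `i` is recomputed in this iteration: its number of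
observations has reached a new level `k_l`. -/
def Updates (st : State N) (ch : Choices N) (δ : ℝ) (i : Item N) : Prop :=
  epoch N δ (st.count i) < epoch N δ (st.newCount ch i)

/-- Empirical mean after the iteration. -/
def newMean (st : State N) (ch : Choices N) (x : Item N → Item N → ℕ → ℝ) (i : Item N) : ℝ :=
  st.newTotal ch x i / (st.newCount ch i : ℝ)

/-- Half-width `√(log β_l / k_l)` of the confidence interval. -/
def newWidth (st : State N) (ch : Choices N) (δ : ℝ) (i : Item N) : ℝ :=
  Real.sqrt (Real.log (beta N δ (epoch N δ (st.newCount ch i))) /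
    (kLevel N δ (epoch N δ (st.newCount ch i)) : ℝ))

open Classical in
/-- `Q₋` after the iteration. -/
def newLo (st : State N) (ch : Choices N) (δ : ℝ) (x : Item N → Item N → ℕ → ℝ) (i : Item N) :
    EReal :=
  if st.Updates ch δ i then ((st.newMean ch x i - st.newWidth ch δ i : ℝ) : EReal) else st.lo i

open Classical in
/-- `Q₊` after the iteration. -/
def newHi (st : State N) (ch : Choices N) (δ : ℝ) (x : Item N → Item N → ℕ → ℝ) (i : Item N) :
    EReal :=
  if st.Updates ch δ i then ((st.newMean ch x i + st.newWidth ch δ i : ℝ) : EReal) else st.hi i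

open Classical in
/-- A cluster is split between an upper part `V` and the rest when every confidence interval of
`V` lies strictly above every confidence interval of the rest; the items of `V` are from then on
known to be better than those of the rest. -/
def newAbove (st : State N) (lo hi : Item N → EReal) (i : Item N) : Finset (Item N) :=
  st.above i ∪ Finset.univ.filter fun j => ∃ V ⊆ st.cluster i, j ∈ V ∧ i ∉ V ∧
    ∀ v ∈ V, ∀ k ∈ st.cluster i \ V, hi k < lo v

open Classical in
/-- One iteration of the main loop; nothing happens any more once all items are ranked. -/
def step (st : State N) (ch : Choices N) (δ : ℝ) (x : Item N → Item N → ℕ → ℝ) : State N :=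
  if st.unranked = ∅ then st else
    { time := st.time + st.rounds ch
      total := st.newTotal ch x
      count := st.newCount ch
      lo := st.newLo ch δ x
      hi := st.newHi ch δ x
      above := st.newAbove (st.newLo ch δ x) (st.newHi ch δ x) }

/-- The matching `m` is the one read off from a final state: the items of ranks `2k-1` and `2k`
are matched, where the order inside a cluster `{2k-1, 2k}` is irrelevant. -/
def Returns (st : State N) (m : Item N → Item N) : Prop :=
  ∀ i j, m i = j ↔ i ≠ j ∧ st.level i / 2 = st.level j / 2

end State

/-- The state after `n` iterations, for the observations `x`. -/
def run {N : ℕ} (ch : Choices N) (δ : ℝ) (x : Item N → Item N → ℕ → ℝ) : ℕ → State N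
  | 0 => State.init N
  | n + 1 => (run ch δ x n).step ch δ x

/-- On the observations `x` the algorithm stops after having sampled at most `b` matchings, and
the matching that it returns is optimal. -/
def IdentifiesWithin {N : ℕ} (u : Item N → ℝ) (ch : Choices N) (δ : ℝ)
    (x : Item N → Item N → ℕ → ℝ) (b : ℝ) : Prop :=
  ∃ n, (run ch δ x n).unranked = ∅ ∧ ((run ch δ x n).time : ℝ) ≤ b ∧
    ∃ m, (run ch δ x n).Returns m ∧ IsOptimalMatching u m

/-- For every confidence parameter `δ > 0`, every choice left open by the algorithm and every
noise, with probability at least `1 - δ` the algorithm returns an optimal matching after at most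
`b δ` samples. -/
def SampleComplexityLE {N : ℕ} (u : Item N → ℝ) (b : ℝ → ℝ) : Prop :=
  ∀ δ : ℝ, 0 < δ → ∀ (ch : Choices N) (Ω : Type w) [MeasurableSpace Ω] (μ : Measure Ω)
    [IsProbabilityMeasure μ] (ε : Sym2 (Item N) → ℕ → Ω → ℝ), IsNoise μ ε →
    ENNReal.ofReal (1 - δ) ≤ μ {ω | IdentifiesWithin u ch δ (observation u ε ω) (b δ)}

end

end MatchingId

namespace MatchingId

namespace State

variable {N : ℕ}

lemma recorded_eq_empty {st : State N} (ch : Choices N) {i : Item N} (hi : i ∉ st.unranked) :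
    st.recorded ch i = ∅ := by
  simp [recorded, hi]

lemma even_card_active (st : State N) (ch : Choices N) : Even (st.active ch).card := by
  unfold active
  split_ifs with h
  · exact h
  · have hne : (st.candidates ∪ st.unranked)ᶜ.Nonempty := by
      rw [Finset.nonempty_iff_ne_empty]
      intro h0
      rw [Finset.compl_eq_empty_iff] at h0
      apply h
      rw [h0]
      simp
    have := ch.best_mem st.level _ hne
    rw [Finset.mem_compl] at this
    rw [Finset.card_insert_of_notMem this]
    rw [Nat.not_even_iff_odd] at h
    exact h.add_one

lemma union_subset_active (st : State N) (ch : Choices N) :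
    st.candidates ∪ st.unranked ⊆ st.active ch := by
  unfold active
  split_ifs with h
  · exact subset_rfl
  · exact Finset.subset_insert _ _

lemma card_active_le (st : State N) (ch : Choices N) :
    (st.active ch).card ≤ (st.candidates ∪ st.unranked).card + 1 := by
  unfold active
  split_ifs with h
  · omega
  · exact Finset.card_insert_le _ _

lemma sum_recorded {M : Type*} [AddCommMonoid M] {st : State N} (ch : Choices N) {i : Item N}
    (hi : i ∈ st.unranked) (f : Item N → M) :
    ∑ r ∈ st.recorded ch i, f (st.partner ch r i) = ∑ j ∈ st.candidates.erase i, f j := by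
  have hev := st.even_card_active ch
  have hA : i ∈ st.active ch := st.union_subset_active ch (Finset.mem_union_right _ hi)
  refine Finset.sum_bij (fun r _ => st.partner ch r i) ?_ ?_ ?_ ?_
  · intro r hr
    simp only [recorded, Finset.mem_filter, Finset.mem_range] at hr
    exact Finset.mem_erase.2 ⟨(ch.isMaxMatching _ hev r hr.1).2 i, hr.2.2⟩
  · intro r hr r' hr' h
    simp only [recorded, Finset.mem_filter, Finset.mem_range] at hr hr'
    have hm := ch.mapsTo _ hev r hr.1 i hA
    have hne : i ≠ st.partner ch r i := ((ch.isMaxMatching _ hev r hr.1).2 i).symm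
    exact (ch.roundRobin _ hev i hA (st.partner ch r i) hm hne).unique ⟨hr.1, rfl⟩ ⟨hr'.1, h.symm⟩
  · intro j hj
    rw [Finset.mem_erase] at hj
    have hjA : j ∈ st.active ch := st.union_subset_active ch (Finset.mem_union_left _ hj.2)
    obtain ⟨r, ⟨hr, hrj⟩, -⟩ := ch.roundRobin _ hev i hA j hjA (Ne.symm hj.1)
    refine ⟨r, ?_, hrj⟩
    simp only [recorded, Finset.mem_filter, Finset.mem_range]
    exact ⟨hr, hi, by rw [show st.partner ch r i = j from hrj]; exact hj.2⟩
  · intro r _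
    rfl

lemma card_recorded {st : State N} (ch : Choices N) {i : Item N} (hi : i ∈ st.unranked) :
    (st.recorded ch i).card = (st.candidates.erase i).card := by
  simpa using sum_recorded ch hi (fun _ => (1 : ℕ))

section Step

variable (st : State N) (ch : Choices N) (δ : ℝ) (x : Item N → Item N → ℕ → ℝ)

lemma step_of_eq_empty (h : st.unranked = ∅) : st.step ch δ x = st := by
  simp [step, h]

lemma step_total (i : Item N) : (st.step ch δ x).total i = st.newTotal ch x i := by
  unfold step
  split_ifs with h
  · simp [newTotal, recorded, h]
  · rfl

lemma step_count (i : Item N) : (st.step ch δ x).count i = st.newCount ch i := by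
  unfold step
  split_ifs with h
  · simp [newCount, recorded, h]
  · rfl

lemma not_updates_of_notMem {i : Item N} (h : i ∉ st.unranked) : ¬ st.Updates ch δ i := by
  simp [Updates, newCount, recorded_eq_empty ch h]

lemma step_lo (i : Item N) : (st.step ch δ x).lo i = st.newLo ch δ x i := by
  unfold step
  split_ifs with h
  · rw [newLo, if_neg (not_updates_of_notMem _ _ _ (by simp [h]))]
  · rfl

lemma step_hi (i : Item N) : (st.step ch δ x).hi i = st.newHi ch δ x i := by
  unfold step
  split_ifs with h
  · rw [newHi, if_neg (not_updates_of_notMem _ _ _ (by simp [h]))]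
  · rfl

lemma step_above (h : st.unranked.Nonempty) (i : Item N) : (st.step ch δ x).above i =
    st.newAbove (st.newLo ch δ x) (st.newHi ch δ x) i := by
  unfold step
  rw [if_neg h.ne_empty]

lemma step_time (h : st.unranked.Nonempty) :
    (st.step ch δ x).time = st.time + st.rounds ch := by
  unfold step
  rw [if_neg h.ne_empty]

lemma above_subset_step (i : Item N) : st.above i ⊆ (st.step ch δ x).above i := by
  rcases st.unranked.eq_empty_or_nonempty with h | h
  · rw [step_of_eq_empty _ _ _ _ h]
  · rw [step_above _ _ _ _ h]
    exact Finset.subset_union_left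

end Step

/-- The relation `j ∈ above i` is a strict weak order which agrees with the parameters. -/
structure Ordered (st : State N) (u : Item N → ℝ) : Prop where
  lt_of_mem : ∀ {i j}, j ∈ st.above i → u i < u j
  mem_or_mem : ∀ {i j} (k), j ∈ st.above i → k ∈ st.above i ∨ j ∈ st.above k

namespace Ordered

variable {st : State N} {u : Item N → ℝ}

lemma notMem_self (h : st.Ordered u) (i : Item N) : i ∉ st.above i := fun hi =>
  lt_irrefl _ (h.lt_of_mem hi)

lemma trichotomy (h : st.Ordered u) (i j : Item N) :
    i ∈ st.above j ∨ j ∈ st.above i ∨ st.above i = st.above j := by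
  by_cases h1 : i ∈ st.above j
  · exact Or.inl h1
  by_cases h2 : j ∈ st.above i
  · exact Or.inr (Or.inl h2)
  refine Or.inr (Or.inr ?_)
  ext k
  constructor
  · intro hk
    exact (h.mem_or_mem j hk).resolve_left h2
  · intro hk
    exact (h.mem_or_mem i hk).resolve_left h1


lemma newAbove (h : st.Ordered u) {lo hi : Item N → EReal}
    (hc : ∀ i j, st.above i = st.above j → u i ≤ u j → lo i ≤ hi j) :
    (∀ i j, j ∈ st.newAbove lo hi i → u i < u j) ∧
    (∀ i j k, j ∈ st.newAbove lo hi i → k ∈ st.newAbove lo hi i ∨ j ∈ st.newAbove lo hi k) := by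
  simp only [State.newAbove, Finset.mem_union, Finset.mem_filter, Finset.mem_univ, true_and]
  constructor
  · rintro i j (hj | ⟨V, hV, hj, hi', hsep⟩)
    · exact h.lt_of_mem hj
    · by_contra! hu
      have h1 : st.above j = st.above i := by simpa [cluster] using hV hj
      exact absurd (hsep j hj i (by simp [cluster, hi'])) (not_lt.2 (hc j i h1 hu))
  · rintro i j k (hj | ⟨V, hV, hj, hi', hsep⟩)
    · rcases h.mem_or_mem k hj with h1 | h1
      · exact Or.inl (Or.inl h1)
      · exact Or.inr (Or.inl h1)
    · have h1 : st.above j = st.above i := by simpa [cluster] using hV hj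
      rcases h.trichotomy i k with h2 | h2 | h2
      · rcases h.mem_or_mem j h2 with h3 | h3
        · exact Or.inr (Or.inl h3)
        · rw [h1] at h3
          exact absurd h3 (h.notMem_self i)
      · exact Or.inl (Or.inl h2)
      · by_cases hk : k ∈ V
        · exact Or.inl (Or.inr ⟨V, hV, hk, hi', hsep⟩)
        · have hcl : st.cluster k = st.cluster i := by simp [cluster, h2]
          exact Or.inr (Or.inr ⟨V, hcl ▸ hV, hj, hk, hcl ▸ hsep⟩)

variable (hu : Antitone u)
include hu

lemma lt_of_mem_above (h : st.Ordered u) {i j : Item N} (hj : j ∈ st.above i) : j < i := by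
  by_contra! hle
  exact absurd (hu hle) (not_le.2 (h.lt_of_mem hj))

lemma mem_above_of_le (h : st.Ordered u) {i j k : Item N} (hk : k ∈ st.above i) (hjk : j ≤ k) :
    j ∈ st.above i := by
  rcases h.mem_or_mem j hk with h1 | h1
  · exact h1
  · exact absurd (h.lt_of_mem_above hu h1) (not_lt.2 hjk)

lemma level_le (h : st.Ordered u) (i : Item N) : st.level i ≤ i := by
  have : st.above i ⊆ Finset.Iio i := fun j hj => Finset.mem_Iio.2 (h.lt_of_mem_above hu hj)
  simpa [level] using Finset.card_le_card this

lemma lt_level (h : st.Ordered u) {i j : Item N} (hj : j ∈ st.above i) : (j : ℕ) < st.level i := by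
  have : Finset.Iic j ⊆ st.above i := fun k hk => h.mem_above_of_le hu hj (Finset.mem_Iic.1 hk)
  have := Finset.card_le_card this
  rw [Fin.card_Iic] at this
  exact this

lemma mem_above_or_eq (h : st.Ordered u) {i j : Item N} (hij : i ≤ j) :
    i ∈ st.above j ∨ st.above i = st.above j := by
  rcases h.trichotomy i j with h1 | h1 | h1
  · exact Or.inl h1
  · exact absurd (h.lt_of_mem_above hu h1) (not_lt.2 hij)
  · exact Or.inr h1

lemma level_mono (h : st.Ordered u) {i j : Item N} (hij : i ≤ j) : st.level i ≤ st.level j := by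
  rcases h.mem_above_or_eq hu hij with h1 | h1
  · exact (h.level_le hu i).trans (h.lt_level hu h1).le
  · simp [level, h1]

lemma above_eq_of_le_of_le (h : st.Ordered u) {i j k : Item N} (hij : i ≤ j) (hjk : j ≤ k)
    (hik : st.above i = st.above k) : st.above j = st.above i := by
  rcases h.mem_above_or_eq hu hij with h1 | h1
  · have := h.lt_level hu h1
    have h2 := h.level_mono hu hjk
    have h3 : st.level k = st.level i := by simp [level, hik]
    have := h.level_le hu i
    omega
  · exact h1.symm

end Ordered

end State

section Levels

variable {N : ℕ} {δ : ℝ}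

lemma three_mul_le_beta (hN : 2 ≤ N) (hδ : 0 < δ) (hδ1 : δ < 1) (l : ℕ) :
    3 * (l : ℝ) ≤ beta N δ l := by
  have h1 : 1 ≤ Real.sqrt (2 * (N : ℝ) / (3 * δ)) := by
    rw [Real.one_le_sqrt, le_div_iff₀ (by positivity)]
    have : (2 : ℝ) ≤ N := by exact_mod_cast hN
    linarith
  have h2 : 3 ≤ Real.pi * Real.sqrt (2 * (N : ℝ) / (3 * δ)) := by
    nlinarith [Real.pi_gt_three]
  exact mul_le_mul_of_nonneg_right h2 (Nat.cast_nonneg l)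

lemma one_le_log_beta (hN : 2 ≤ N) (hδ : 0 < δ) (hδ1 : δ < 1) {l : ℕ} (hl : 1 ≤ l) :
    1 ≤ Real.log (beta N δ l) := by
  have h := three_mul_le_beta hN hδ hδ1 l
  have hl' : (1 : ℝ) ≤ l := by exact_mod_cast hl
  have h3 : 3 ≤ beta N δ l := by linarith
  rw [Real.le_log_iff_exp_le (by linarith)]
  exact (Real.exp_one_lt_d9.le.trans (by norm_num)).trans h3

lemma log_beta_mono (hN : 2 ≤ N) (hδ : 0 < δ) (hδ1 : δ < 1) {l m : ℕ} (hl : 1 ≤ l)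
    (hlm : l ≤ m) : Real.log (beta N δ l) ≤ Real.log (beta N δ m) := by
  have h := three_mul_le_beta hN hδ hδ1 l
  have hl' : (1 : ℝ) ≤ l := by exact_mod_cast hl
  refine Real.log_le_log (by linarith) ?_
  unfold beta
  gcongr

lemma le_kLevel (l : ℕ) : (4 : ℝ) ^ (l + 1) * Real.log (beta N δ l) ≤ kLevel N δ l := Nat.le_ceil _

lemma four_pow_le_kLevel (hN : 2 ≤ N) (hδ : 0 < δ) (hδ1 : δ < 1) {l : ℕ} (hl : 1 ≤ l) :
    4 ^ (l + 1) ≤ kLevel N δ l := by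
  have h := le_kLevel (N := N) (δ := δ) l
  have h1 := one_le_log_beta hN hδ hδ1 hl
  have h2 : (4 : ℝ) ^ (l + 1) ≤ kLevel N δ l :=
    (le_mul_of_one_le_right (by positivity) h1).trans h
  exact_mod_cast h2

lemma self_le_kLevel (hN : 2 ≤ N) (hδ : 0 < δ) (hδ1 : δ < 1) (l : ℕ) : l ≤ kLevel N δ l := by
  rcases Nat.eq_zero_or_pos l with rfl | hl
  · exact Nat.zero_le _
  · exact ((Nat.lt_succ_self l).trans (Nat.lt_pow_self (by norm_num))).le.trans
      (four_pow_le_kLevel hN hδ hδ1 hl)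

lemma kLevel_mono (hN : 2 ≤ N) (hδ : 0 < δ) (hδ1 : δ < 1) {l m : ℕ} (hl : 1 ≤ l)
    (hlm : l ≤ m) : kLevel N δ l ≤ kLevel N δ m := by
  have h1 := one_le_log_beta hN hδ hδ1 hl
  refine Nat.ceil_mono (mul_le_mul ?_ (log_beta_mono hN hδ hδ1 hl hlm) (by linarith)
    (by positivity))
  exact pow_le_pow_right₀ (by norm_num) (by omega)

lemma kLevel_epoch_le {c : ℕ} (h : epoch N δ c ≠ 0) : kLevel N δ (epoch N δ c) ≤ c := by
  have := Nat.findGreatest_of_ne_zero (P := fun l => kLevel N δ l ≤ c) (n := c) rfl h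
  exact this

lemma le_epoch (hN : 2 ≤ N) (hδ : 0 < δ) (hδ1 : δ < 1) {l c : ℕ} (h : kLevel N δ l ≤ c) :
    l ≤ epoch N δ c :=
  Nat.le_findGreatest ((self_le_kLevel hN hδ hδ1 l).trans h) h

lemma sqrt_log_beta_div_kLevel_le (hN : 2 ≤ N) (hδ : 0 < δ) (hδ1 : δ < 1) {l : ℕ} (hl : 1 ≤ l) :
    Real.sqrt (Real.log (beta N δ l) / (kLevel N δ l : ℝ)) ≤ (1 / 2) ^ (l + 1) := by
  have h := le_kLevel (N := N) (δ := δ) l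
  have h1 := one_le_log_beta hN hδ hδ1 hl
  have hk : (0 : ℝ) < kLevel N δ l := lt_of_lt_of_le (by positivity) h
  refine Real.sqrt_le_iff.2 ⟨by positivity, ?_⟩
  rw [div_le_iff₀ hk, ← pow_mul, mul_comm (l + 1) 2, pow_mul]
  calc Real.log (beta N δ l) = ((1 / 2 : ℝ) ^ 2) ^ (l + 1) *
        ((4 : ℝ) ^ (l + 1) * Real.log (beta N δ l)) := by
        rw [← mul_assoc, ← mul_pow]; norm_num
    _ ≤ _ := by gcongr

end Levels

noncomputable section

variable {N : ℕ} (u : Item N → ℝ) (ch : Choices N) (δ : ℝ) (x : Item N → Item N → ℕ → ℝ)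

/-- The sum of the expectations of the recorded observations of item `i`. -/
def meanTotal : ℕ → Item N → ℝ
  | 0, _ => 0
  | n + 1, i => meanTotal n i +
      ∑ r ∈ (run ch δ x n).recorded ch i, u i * u ((run ch δ x n).partner ch r i)

/-- The sum of the parameters of the recorded partners of `i`, other than `j`. -/
def mass : ℕ → Item N → Item N → ℝ
  | 0, _, _ => 0
  | n + 1, i, j => mass n i j + if i ∈ (run ch δ x n).unranked then
      ∑ b ∈ ((run ch δ x n).candidates.erase i).erase j, u b else 0

/-- Whenever a confidence interval is computed, it contains the expectation of the mean. -/
def Concentrates : Prop := ∀ n i, (run ch δ x n).Updates ch δ i →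
  |(run ch δ x n).newTotal ch x i - meanTotal u ch δ x (n + 1) i| ≤
    (run ch δ x n).newCount ch i * (run ch δ x n).newWidth ch δ i

variable {u ch δ x}

lemma meanTotal_succ_of_mem {n : ℕ} {i : Item N} (hi : i ∈ (run ch δ x n).unranked) :
    meanTotal u ch δ x (n + 1) i = meanTotal u ch δ x n i +
      u i * ∑ b ∈ (run ch δ x n).candidates.erase i, u b := by
  rw [meanTotal, ← State.sum_recorded ch hi u, Finset.mul_sum]

lemma meanTotal_succ_of_notMem {n : ℕ} {i : Item N} (hi : i ∉ (run ch δ x n).unranked) :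
    meanTotal u ch δ x (n + 1) i = meanTotal u ch δ x n i := by
  rw [meanTotal, State.recorded_eq_empty ch hi, Finset.sum_empty, add_zero]

lemma count_succ_of_mem {n : ℕ} {i : Item N} (hi : i ∈ (run ch δ x n).unranked) :
    (run ch δ x (n + 1)).count i = (run ch δ x n).count i +
      ((run ch δ x n).candidates.erase i).card := by
  rw [run, State.step_count, State.newCount, State.card_recorded ch hi]

lemma count_succ_of_notMem {n : ℕ} {i : Item N} (hi : i ∉ (run ch δ x n).unranked) :
    (run ch δ x (n + 1)).count i = (run ch δ x n).count i := by
  rw [run, State.step_count, State.newCount, State.recorded_eq_empty ch hi, Finset.card_empty,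
    add_zero]

lemma mass_nonneg (hpos : ∀ i, 0 < u i) (n : ℕ) (i j : Item N) : 0 ≤ mass u ch δ x n i j := by
  induction n with
  | zero => exact le_rfl
  | succ n ih =>
    rw [mass]
    refine add_nonneg ih ?_
    split_ifs
    · exact Finset.sum_nonneg fun b _ => (hpos b).le
    · exact le_rfl

lemma State.unranked_congr {st : State N} {i j : Item N} (h : st.above i = st.above j) :
    i ∈ st.unranked ↔ j ∈ st.unranked := by
  simp [State.unranked, State.Ranked, State.cluster, State.level, h]

lemma State.mem_candidates {st : State N} {i : Item N} :
    i ∈ st.candidates ↔ st.level i < st.unranked.card := by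
  simp [State.candidates]

lemma State.candidates_congr {st : State N} {i j : Item N} (h : st.above i = st.above j) :
    i ∈ st.candidates ↔ j ∈ st.candidates := by
  simp [State.mem_candidates, State.level, h]

lemma mul_sum_erase_sub {ι : Type*} [DecidableEq ι] (u : ι → ℝ) (B : Finset ι) {i j : ι}
    (h : i ∈ B ↔ j ∈ B) : u i * ∑ b ∈ B.erase i, u b - u j * ∑ b ∈ B.erase j, u b =
      (u i - u j) * ∑ b ∈ (B.erase i).erase j, u b := by
  by_cases hi : i ∈ B
  · rcases eq_or_ne i j with rfl | hne
    · simp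
    · have hj := h.1 hi
      have h1 := Finset.add_sum_erase (B.erase i) u (Finset.mem_erase.2 ⟨hne.symm, hj⟩)
      have h2 := Finset.add_sum_erase (B.erase j) u (Finset.mem_erase.2 ⟨hne, hi⟩)
      rw [Finset.erase_right_comm] at h2
      rw [← h1, ← h2]
      ring
  · have hj := fun h' => hi (h.2 h')
    rw [Finset.erase_eq_of_notMem hi, Finset.erase_eq_of_notMem hj]
    ring

variable (u ch δ x) in
/-- The facts about the state after `n` iterations on which correctness rests. -/
structure Invariant (n : ℕ) : Prop where
  ordered : (run ch δ x n).Ordered u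
  lo_le_hi : ∀ i j, (run ch δ x n).above i = (run ch δ x n).above j → u i ≤ u j →
    (run ch δ x n).lo i ≤ (run ch δ x n).hi j
  count_eq : ∀ i j, (run ch δ x n).above i = (run ch δ x n).above j →
    (run ch δ x n).count i = (run ch δ x n).count j
  meanTotal_sub : ∀ i j, (run ch δ x n).above i = (run ch δ x n).above j →
    meanTotal u ch δ x n i - meanTotal u ch δ x n j = (u i - u j) * mass u ch δ x n i j

lemma Invariant.newCount_eq {n : ℕ} (h : Invariant u ch δ x n) {i j : Item N}
    (hij : (run ch δ x n).above i = (run ch δ x n).above j) :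
    (run ch δ x n).newCount ch i = (run ch δ x n).newCount ch j := by
  rw [← State.step_count _ _ δ x, ← State.step_count _ _ δ x]
  change (run ch δ x (n + 1)).count i = (run ch δ x (n + 1)).count j
  by_cases hi : i ∈ (run ch δ x n).unranked
  · have hj := (State.unranked_congr hij).1 hi
    rw [count_succ_of_mem hi, count_succ_of_mem hj, h.count_eq i j hij]
    congr 1
    have hB := State.candidates_congr hij
    by_cases hb : i ∈ (run ch δ x n).candidates
    · rw [Finset.card_erase_of_mem hb, Finset.card_erase_of_mem (hB.1 hb)]
    · rw [Finset.erase_eq_of_notMem hb, Finset.erase_eq_of_notMem fun h' => hb (hB.2 h')]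
  · have hj := fun h' => hi ((State.unranked_congr hij).2 h')
    rw [count_succ_of_notMem hi, count_succ_of_notMem hj, h.count_eq i j hij]

lemma Invariant.meanTotal_succ_sub {n : ℕ} (h : Invariant u ch δ x n) {i j : Item N}
    (hij : (run ch δ x n).above i = (run ch δ x n).above j) :
    meanTotal u ch δ x (n + 1) i - meanTotal u ch δ x (n + 1) j =
      (u i - u j) * mass u ch δ x (n + 1) i j := by
  have h0 := h.meanTotal_sub i j hij
  rw [mass]
  by_cases hi : i ∈ (run ch δ x n).unranked
  · have hj := (State.unranked_congr hij).1 hi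
    rw [meanTotal_succ_of_mem hi, meanTotal_succ_of_mem hj, if_pos hi]
    have h1 := mul_sum_erase_sub u (run ch δ x n).candidates (State.candidates_congr hij)
    linarith
  · have hj := fun h' => hi ((State.unranked_congr hij).2 h')
    rw [meanTotal_succ_of_notMem hi, meanTotal_succ_of_notMem hj, if_neg hi]
    linarith

lemma Invariant.updates_iff {n : ℕ} (h : Invariant u ch δ x n) {i j : Item N}
    (hij : (run ch δ x n).above i = (run ch δ x n).above j) :
    (run ch δ x n).Updates ch δ i ↔ (run ch δ x n).Updates ch δ j := by
  rw [State.Updates, State.Updates, h.newCount_eq hij, h.count_eq i j hij]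

lemma State.newCount_pos_of_updates (hN : 2 ≤ N) (hδ : 0 < δ) (hδ1 : δ < 1) {st : State N}
    {i : Item N} (h : st.Updates ch δ i) : 0 < st.newCount ch i := by
  have h0 : epoch N δ (st.newCount ch i) ≠ 0 := (Nat.zero_le _).trans_lt h |>.ne'
  exact (Nat.pos_of_ne_zero h0).trans_le ((self_le_kLevel hN hδ hδ1 _).trans (kLevel_epoch_le h0))

section

variable (hN : 2 ≤ N) (hδ : 0 < δ) (hδ1 : δ < 1)
include hN hδ hδ1

lemma Concentrates.abs_newMean_sub_le (hc : Concentrates u ch δ x) {n : ℕ} {i : Item N}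
    (h : (run ch δ x n).Updates ch δ i) :
    |(run ch δ x n).newMean ch x i -
      meanTotal u ch δ x (n + 1) i / (run ch δ x n).newCount ch i| ≤
        (run ch δ x n).newWidth ch δ i := by
  have hpos : (0 : ℝ) < (run ch δ x n).newCount ch i := by
    exact_mod_cast State.newCount_pos_of_updates hN hδ hδ1 h
  rw [State.newMean, ← sub_div, abs_div, abs_of_pos hpos, div_le_iff₀ hpos, mul_comm]
  exact hc n i h

variable (hpos : ∀ i, 0 < u i)
include hpos

lemma Invariant.newLo_le_newHi (hc : Concentrates u ch δ x) {n : ℕ}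
    (h : Invariant u ch δ x n) {i j : Item N}
    (hij : (run ch δ x n).above i = (run ch δ x n).above j) (huij : u i ≤ u j) :
    (run ch δ x n).newLo ch δ x i ≤ (run ch δ x n).newHi ch δ x j := by
  by_cases hi : (run ch δ x n).Updates ch δ i
  · have hj := (h.updates_iff hij).1 hi
    rw [State.newLo, if_pos hi, State.newHi, if_pos hj, EReal.coe_le_coe_iff]
    have h1 := abs_le.1 (hc.abs_newMean_sub_le hN hδ hδ1 hi)
    have h2 := abs_le.1 (hc.abs_newMean_sub_le hN hδ hδ1 hj)
    have h3 := h.meanTotal_succ_sub hij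
    have h4 : meanTotal u ch δ x (n + 1) i / (run ch δ x n).newCount ch i ≤
        meanTotal u ch δ x (n + 1) j / (run ch δ x n).newCount ch j := by
      rw [h.newCount_eq hij]
      refine div_le_div_of_nonneg_right ?_ (Nat.cast_nonneg _)
      have := mul_nonneg (sub_nonneg.2 huij) (mass_nonneg (ch := ch) (δ := δ) (x := x) hpos (n + 1) i j)
      linarith
    linarith [h1.2, h2.1]
  · have hj := fun h' => hi ((h.updates_iff hij).2 h')
    rw [State.newLo, if_neg hi, State.newHi, if_neg hj]
    exact h.lo_le_hi i j hij huij

lemma Invariant.ordered_succ (hc : Concentrates u ch δ x) {n : ℕ}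
    (h : Invariant u ch δ x n) : (run ch δ x (n + 1)).Ordered u := by
  rw [run]
  rcases (run ch δ x n).unranked.eq_empty_or_nonempty with h0 | h0
  · rw [State.step_of_eq_empty _ _ _ _ h0]
    exact h.ordered
  · have h1 := h.ordered.newAbove (lo := (run ch δ x n).newLo ch δ x)
      (hi := (run ch δ x n).newHi ch δ x)
      fun i j hij huij => h.newLo_le_newHi hN hδ hδ1 hpos hc hij huij
    refine ⟨fun {i j} hj => ?_, fun {i j} k hj => ?_⟩
    · rw [State.step_above _ _ _ _ h0] at hj
      exact h1.1 i j hj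
    · simp only [State.step_above _ _ _ _ h0] at hj ⊢
      exact h1.2 i j k hj

omit hN hδ hδ1 hpos in
lemma above_eq_of_succ {n : ℕ} (h : (run ch δ x n).Ordered u)
    (h' : (run ch δ x (n + 1)).Ordered u) {i j : Item N}
    (hij : (run ch δ x (n + 1)).above i = (run ch δ x (n + 1)).above j) :
    (run ch δ x n).above i = (run ch δ x n).above j := by
  rcases h.trichotomy i j with h1 | h1 | h1
  · have := State.above_subset_step _ ch δ x j h1
    exact absurd (hij ▸ this) (h'.notMem_self i)
  · have := State.above_subset_step _ ch δ x i h1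
    exact absurd (hij ▸ this) (h'.notMem_self j)
  · exact h1

lemma Concentrates.invariant (hc : Concentrates u ch δ x) (n : ℕ) : Invariant u ch δ x n := by
  induction n with
  | zero =>
    refine ⟨⟨fun {i j} h => ?_, fun {i j} k h => ?_⟩, fun _ _ _ _ => ?_, fun _ _ _ => rfl,
      fun _ _ _ => ?_⟩
    · simp [run, State.init] at h
    · simp [run, State.init] at h
    · simp [run, State.init]
    · simp [meanTotal, mass]
  | succ n ih =>
    have ho := ih.ordered_succ hN hδ hδ1 hpos hc
    refine ⟨ho, fun i j hij huij => ?_, fun i j hij => ?_, fun i j hij => ?_⟩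
    all_goals have hij' := above_eq_of_succ ih.ordered ho hij
    · rw [run, State.step_lo, State.step_hi]
      exact ih.newLo_le_newHi hN hδ hδ1 hpos hc hij' huij
    · rw [run, State.step_count, State.step_count]
      exact ih.newCount_eq hij'
    · exact ih.meanTotal_succ_sub hij'

end

end

namespace State

variable {N : ℕ} {st : State N} {u : Item N → ℝ}

/-- The items `2k` and `2k+1` (1-based) are still in the same cluster. -/
def Unsplit (st : State N) (k : Fin (N - 1)) : Prop :=
  st.above (upperItem k) = st.above (lowerItem k)

lemma mem_cluster {i j : Item N} : j ∈ st.cluster i ↔ st.above j = st.above i := by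
  simp [cluster]

lemma mem_unranked {i : Item N} : i ∈ st.unranked ↔ ¬ st.Ranked i := by
  simp [unranked]

lemma Ordered.le_level_of_not_unsplit (h : st.Ordered u) (hu : Antitone u) {k : Fin (N - 1)}
    (hk : ¬ st.Unsplit k) {i : Item N} (hi : 2 * (k : ℕ) + 2 ≤ i) :
    2 * (k : ℕ) + 2 ≤ st.level i := by
  have hle : upperItem k ≤ lowerItem k := by
    simp [upperItem, lowerItem, Fin.le_def]
  have h1 := (h.mem_above_or_eq hu hle).resolve_right hk
  rcases h.mem_or_mem i h1 with h2 | h2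
  · have := h.lt_of_mem_above hu h2
    simp only [lowerItem, Fin.lt_def] at this
    omega
  · have := h.lt_level hu h2
    simp only [upperItem] at this
    omega

lemma Ordered.unsplit_of_div_lt (h : st.Ordered u) (hu : Antitone u) {i j : Item N}
    (hij : st.above i = st.above j) (hlt : (i : ℕ) / 2 < (j : ℕ) / 2) :
    ∃ k, st.Unsplit k ∧ st.above (upperItem k) = st.above i ∧ (k : ℕ) = (i : ℕ) / 2 := by
  have hj := j.2
  let k : Fin (N - 1) := ⟨(i : ℕ) / 2, by omega⟩
  have h1 : i ≤ upperItem k := by simp only [upperItem, Fin.le_def, k]; omega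
  have h2 : upperItem k ≤ lowerItem k := by simp only [upperItem, lowerItem, Fin.le_def]; omega
  have h3 : lowerItem k ≤ j := by simp only [lowerItem, Fin.le_def, k]; omega
  have h4 := h.above_eq_of_le_of_le hu h1 (h2.trans h3) hij
  have h5 := h.above_eq_of_le_of_le hu (h1.trans h2) h3 hij
  exact ⟨k, h4.trans h5.symm, h4, rfl⟩

lemma Ordered.exists_unsplit (h : st.Ordered u) (hu : Antitone u) {i : Item N}
    (hi : i ∈ st.unranked) : ∃ k, st.Unsplit k ∧ st.above (upperItem k) = st.above i := by
  rw [mem_unranked] at hi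
  by_contra! hno
  apply hi
  have hcl : ∀ j, st.above j = st.above i → (j : ℕ) / 2 = (i : ℕ) / 2 := by
    intro j hj
    rcases lt_trichotomy ((j : ℕ) / 2) ((i : ℕ) / 2) with h1 | h1 | h1
    · obtain ⟨k, hk, hk', -⟩ := h.unsplit_of_div_lt hu hj h1
      exact absurd (hk'.trans hj) (hno k hk)
    · exact h1
    · obtain ⟨k, hk, hk', -⟩ := h.unsplit_of_div_lt hu hj.symm h1
      exact absurd hk' (hno k hk)
  have hi2 := i.2
  let z : Item N := ⟨2 * ((i : ℕ) / 2), by omega⟩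
  let z' : Item N := ⟨2 * ((i : ℕ) / 2) + 1, by omega⟩
  have hsub : st.cluster i ⊆ {z, z'} := by
    intro j hj
    have := hcl j (mem_cluster.1 hj)
    simp only [Finset.mem_insert, Finset.mem_singleton, Fin.ext_iff, z, z']
    omega
  have hcard : ({z, z'} : Finset (Item N)).card = 2 :=
    Finset.card_pair (by simp [z, z', Fin.ext_iff])
  have hle := Finset.card_le_card hsub
  have hpos : 0 < (st.cluster i).card := Finset.card_pos.2 ⟨i, mem_cluster.2 rfl⟩
  rcases (show (st.cluster i).card = 1 ∨ (st.cluster i).card = 2 by omega) with h1 | h1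
  · exact Or.inl h1
  · refine Or.inr ⟨h1, ?_⟩
    have heq := Finset.eq_of_subset_of_card_le hsub (by omega)
    have hz : st.above z = st.above i := mem_cluster.1 (heq ▸ by simp)
    have hl : st.level i = st.level z := by simp [level, hz]
    have h2 := h.level_le hu z
    rw [hl, show st.level z = 2 * ((i : ℕ) / 2) from ?_]
    · exact even_two_mul _
    · refine le_antisymm h2 ?_
      by_contra! hlt
      have hy : (⟨2 * ((i : ℕ) / 2) - 1, by omega⟩ : Item N) ≤ z := by
        simp [z, Fin.le_def]
      rcases h.mem_above_or_eq hu hy with h3 | h3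
      · have := h.lt_level hu h3
        simp only at this
        omega
      · have := hcl _ (h3.trans hz)
        simp only at this
        omega

lemma Ordered.upperItem_mem_unranked (h : st.Ordered u) (hu : Antitone u) {k : Fin (N - 1)}
    (hk : st.Unsplit k) : upperItem k ∈ st.unranked := by
  rw [mem_unranked]
  have hU : upperItem k ∈ st.cluster (upperItem k) := mem_cluster.2 rfl
  have hL : lowerItem k ∈ st.cluster (upperItem k) := mem_cluster.2 hk.symm
  have hne : upperItem k ≠ lowerItem k := by simp [upperItem, lowerItem, Fin.ext_iff]
  have hpair : ({upperItem k, lowerItem k} : Finset (Item N)) ⊆ st.cluster (upperItem k) := by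
    intro j hj
    rcases Finset.mem_insert.1 hj with rfl | hj
    · exact hU
    · rwa [Finset.mem_singleton.1 hj]
  have hc2 := Finset.card_pair hne
  have hk2 := k.2
  rintro (h1 | ⟨h1, h2⟩)
  · have := Finset.card_le_card hpair
    omega
  · have heq := Finset.eq_of_subset_of_card_le hpair (by omega)
    let z : Item N := ⟨2 * (k : ℕ), by omega⟩
    have hz : z ≤ upperItem k := by simp [z, upperItem, Fin.le_def]
    rcases h.mem_above_or_eq hu hz with h3 | h3
    · have h4 := h.lt_level hu h3
      have h5 := h.level_le hu (upperItem k)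
      simp only [upperItem, z] at h4 h5
      have : st.level (upperItem k) = 2 * (k : ℕ) + 1 := by
        simp only [upperItem]; omega
      rw [this] at h2
      exact (Nat.not_even_two_mul_add_one _) h2
    · have : z ∈ ({upperItem k, lowerItem k} : Finset (Item N)) := heq ▸ mem_cluster.2 h3
      simp [z, upperItem, lowerItem, Fin.ext_iff] at this

lemma lowerItem_mem_unranked_of_unsplit {k : Fin (N - 1)} (hk : st.Unsplit k)
    (h : upperItem k ∈ st.unranked) : lowerItem k ∈ st.unranked := (unranked_congr hk).1 h

lemma Ordered.mem_candidates_of_lt (h : st.Ordered u) (hu : Antitone u) {i : Item N}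
    (hi : (i : ℕ) < st.unranked.card) : i ∈ st.candidates :=
  mem_candidates.2 ((h.level_le hu i).trans_lt hi)

lemma Ordered.mem_candidates_of_le (h : st.Ordered u) (hu : Antitone u) {i j : Item N}
    (hij : i ≤ j) (hj : j ∈ st.candidates) : i ∈ st.candidates :=
  mem_candidates.2 ((h.level_mono hu hij).trans_lt (mem_candidates.1 hj))

lemma Ordered.card_unranked_le (h : st.Ordered u) (hu : Antitone u) :
    st.unranked.card ≤ st.candidates.card := by
  have hle : st.unranked.card ≤ 2 * N := by
    simpa using Finset.card_le_univ st.unranked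
  have hsub : (Finset.univ : Finset (Fin st.unranked.card)).map (Fin.castLEEmb hle) ⊆
      st.candidates := by
    intro i hi
    obtain ⟨j, -, rfl⟩ := Finset.mem_map.1 hi
    exact h.mem_candidates_of_lt hu j.2
  simpa using Finset.card_le_card hsub

lemma two_le_card_unranked {k : Fin (N - 1)} (hk : st.Unsplit k)
    (h : upperItem k ∈ st.unranked) : 2 ≤ st.unranked.card := by
  have hne : upperItem k ≠ lowerItem k := by simp [upperItem, lowerItem, Fin.ext_iff]
  rw [← Finset.card_pair hne]
  refine Finset.card_le_card fun j hj => ?_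
  rcases Finset.mem_insert.1 hj with rfl | hj
  · exact h
  · rw [Finset.mem_singleton.1 hj]
    exact lowerItem_mem_unranked_of_unsplit hk h

lemma rounds_le (st : State N) (ch : Choices N) : st.rounds ch ≤ 2 * N := by
  have : (st.active ch).card ≤ 2 * N := by simpa using Finset.card_le_univ (st.active ch)
  unfold rounds
  omega

lemma Ordered.rounds_le_two_mul (h : st.Ordered u) (hu : Antitone u) (ch : Choices N) :
    st.rounds ch ≤ 2 * st.candidates.card := by
  have h1 := st.card_active_le ch
  have h2 := Finset.card_union_le st.candidates st.unranked
  have h3 := h.card_unranked_le hu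
  unfold rounds
  omega

lemma Ordered.card_candidates_le (h : st.Ordered u) (hu : Antitone u) {k : Fin (N - 1)}
    (hk : st.Unsplit k) (i : Item N) :
    st.candidates.card ≤ 2 * (st.candidates.erase i).card := by
  have h1 := two_le_card_unranked hk (h.upperItem_mem_unranked hu hk)
  have h2 := h.card_unranked_le hu
  have h3 := Finset.pred_card_le_card_erase (s := st.candidates) (a := i)
  omega

end State

section Progress

variable {N : ℕ} {u : Item N → ℝ} {ch : Choices N} {δ : ℝ} {x : Item N → Item N → ℕ → ℝ}
  (hu : Antitone u) (hI : ∀ n, Invariant u ch δ x n)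
include hu hI

omit hu in
lemma unsplit_of_succ {n : ℕ} {k : Fin (N - 1)} (h : (run ch δ x (n + 1)).Unsplit k) :
    (run ch δ x n).Unsplit k :=
  above_eq_of_succ (hI n).ordered (hI (n + 1)).ordered h

lemma count_succ_of_unsplit {n : ℕ} {k : Fin (N - 1)} (h : (run ch δ x n).Unsplit k) :
    (run ch δ x (n + 1)).count (upperItem k) = (run ch δ x n).count (upperItem k) +
      ((run ch δ x n).candidates.erase (upperItem k)).card :=
  count_succ_of_mem ((hI n).ordered.upperItem_mem_unranked hu h)

lemma mass_succ_of_unsplit {n : ℕ} {k : Fin (N - 1)} (h : (run ch δ x n).Unsplit k) :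
    mass u ch δ x (n + 1) (upperItem k) (lowerItem k) =
      mass u ch δ x n (upperItem k) (lowerItem k) +
      ∑ b ∈ ((run ch δ x n).candidates.erase (upperItem k)).erase (lowerItem k), u b := by
  rw [mass, if_pos ((hI n).ordered.upperItem_mem_unranked hu h)]

lemma time_le_of_unsplit {n : ℕ} {k : Fin (N - 1)} (h : (run ch δ x n).Unsplit k) :
    (run ch δ x n).time ≤ 4 * (run ch δ x n).count (upperItem k) := by
  induction n with
  | zero => exact Nat.zero_le _
  | succ n ih =>
    have h' := unsplit_of_succ hI h
    have ho := (hI n).ordered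
    rw [count_succ_of_unsplit hu hI h', run,
      State.step_time _ _ _ _ ⟨_, ho.upperItem_mem_unranked hu h'⟩]
    have h1 := ih h'
    have h2 := ho.rounds_le_two_mul hu ch
    have h3 := ho.card_candidates_le hu h' (upperItem k)
    omega

lemma count_le_two_mul_count {n : ℕ} {k l : Fin (N - 1)} (hk : (run ch δ x n).Unsplit k)
    (hl : (run ch δ x n).Unsplit l) : (run ch δ x n).count (upperItem k) ≤
      2 * (run ch δ x n).count (upperItem l) := by
  induction n with
  | zero => exact Nat.zero_le _
  | succ n ih =>
    have hk' := unsplit_of_succ hI hk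
    have hl' := unsplit_of_succ hI hl
    rw [count_succ_of_unsplit hu hI hk', count_succ_of_unsplit hu hI hl']
    have h1 := ih hk' hl'
    have h3 := (hI n).ordered.card_candidates_le hu hl' (upperItem l)
    have h4 := Finset.card_erase_le (s := (run ch δ x n).candidates) (a := upperItem k)
    omega

variable (hN : 2 ≤ N) (hδ : 0 < δ) (hδ1 : δ < 1) (hpos : ∀ i, 0 < u i)
  (hc : Concentrates u ch δ x)
include hN hδ hδ1 hpos hc

lemma gap_mul_mass_le {n : ℕ} {k : Fin (N - 1)} (hk : (run ch δ x (n + 1)).Unsplit k)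
    (hup : (run ch δ x n).Updates ch δ (upperItem k)) :
    gap u k * mass u ch δ x (n + 1) (upperItem k) (lowerItem k) ≤
      4 * (run ch δ x n).newWidth ch δ (upperItem k) *
        (run ch δ x n).newCount ch (upperItem k) := by
  set st := run ch δ x n with hst
  set a := upperItem k with ha
  set b := lowerItem k with hb
  have hk' : st.above a = st.above b := unsplit_of_succ hI hk
  have hinv := hI n
  have hmem := hinv.ordered.upperItem_mem_unranked hu hk'
  have hC : (0 : ℝ) < st.newCount ch a := by
    exact_mod_cast State.newCount_pos_of_updates hN hδ hδ1 hup
  by_contra! hlt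
  have hab : a < b := by simp [a, b, upperItem, lowerItem, Fin.lt_def]
  refine (hI (n + 1)).ordered.notMem_self a ?_
  have hk2 : (run ch δ x (n + 1)).above a = (run ch δ x (n + 1)).above b := hk
  rw [hk2, run, State.step_above _ _ _ _ ⟨_, hmem⟩, State.newAbove]
  refine Finset.mem_union_right _ (Finset.mem_filter.2 ⟨Finset.mem_univ _,
    (st.cluster b).filter (· ≤ a), Finset.filter_subset _ _, ?_, ?_, ?_⟩)
  · exact Finset.mem_filter.2 ⟨State.mem_cluster.2 hk', le_rfl⟩
  · exact fun h => absurd (Finset.mem_filter.1 h).2 (not_le.2 hab)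
  · intro v hv c hc'
    obtain ⟨hv1, hv2⟩ := Finset.mem_filter.1 hv
    obtain ⟨hc1, hc2⟩ := Finset.mem_sdiff.1 hc'
    have hc3 : a < c := by
      by_contra! hle
      exact hc2 (Finset.mem_filter.2 ⟨hc1, hle⟩)
    have hc4 : b ≤ c := by
      simp only [a, b, upperItem, lowerItem, Fin.lt_def, Fin.le_def] at hc3 ⊢
      omega
    have hva : st.above v = st.above a := (State.mem_cluster.1 hv1).trans hk'.symm
    have hca : st.above c = st.above a := (State.mem_cluster.1 hc1).trans hk'.symm
    have hupv := (hinv.updates_iff hva).2 hup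
    have hupc := (hinv.updates_iff hca).2 hup
    have hwv : st.newWidth ch δ v = st.newWidth ch δ a := by
      simp only [State.newWidth, hst, hinv.newCount_eq hva]
    have hwc : st.newWidth ch δ c = st.newWidth ch δ a := by
      simp only [State.newWidth, hst, hinv.newCount_eq hca]
    have h1 := (abs_le.1 (hc.abs_newMean_sub_le hN hδ hδ1 hupv)).1
    have h2 := (abs_le.1 (hc.abs_newMean_sub_le hN hδ hδ1 hupc)).2
    rw [← hst, hwv] at h1
    rw [← hst, hwc] at h2
    rw [hst, hinv.newCount_eq hva, ← hst] at h1
    rw [hst, hinv.newCount_eq hca, ← hst] at h2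
    rw [State.newHi, if_pos hupc, State.newLo, if_pos hupv, EReal.coe_lt_coe_iff, hwv, hwc]
    have e1 := hinv.meanTotal_succ_sub hva
    have e2 := hinv.meanTotal_succ_sub (hk'.symm.trans hca.symm)
    have e3 := hinv.meanTotal_succ_sub hk'
    have p1 := mul_nonneg (sub_nonneg.2 (hu hv2))
      (mass_nonneg (ch := ch) (δ := δ) (x := x) hpos (n + 1) v a)
    have p2 := mul_nonneg (sub_nonneg.2 (hu hc4))
      (mass_nonneg (ch := ch) (δ := δ) (x := x) hpos (n + 1) b c)
    have hg : gap u k = u a - u b := rfl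
    rw [hg] at hlt
    have h3 : 4 * st.newWidth ch δ a <
        meanTotal u ch δ x (n + 1) v / st.newCount ch a -
          meanTotal u ch δ x (n + 1) c / st.newCount ch a := by
      rw [← sub_div, lt_div_iff₀ hC]
      linarith
    linarith

lemma epoch_lt_of_unsplit {k : Fin (N - 1)} (hgap : 0 < gap u k) {L : ℕ} (hL : 1 ≤ L) {ρ : ℝ}
    (hρ : 2 < ρ * gap u k * 2 ^ L)
    (hmass : ∀ n, (run ch δ x n).Unsplit k →
      kLevel N δ L ≤ (run ch δ x n).count (upperItem k) →
      ρ * (run ch δ x n).count (upperItem k) ≤ mass u ch δ x n (upperItem k) (lowerItem k))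
    (n : ℕ) (hk : (run ch δ x n).Unsplit k) :
    epoch N δ ((run ch δ x n).count (upperItem k)) < L := by
  induction n with
  | zero => simpa [run, State.init, epoch] using Nat.lt_of_succ_le hL
  | succ n ih =>
    by_contra! hle
    have hk' := unsplit_of_succ hI hk
    have hcount : (run ch δ x (n + 1)).count (upperItem k) =
      (run ch δ x n).newCount ch (upperItem k) := by rw [run, State.step_count]
    have hup : (run ch δ x n).Updates ch δ (upperItem k) := by
      rw [State.Updates, ← hcount]
      exact (ih hk').trans_le hle
    have h1 := gap_mul_mass_le hu hI hN hδ hδ1 hpos hc hk hup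
    set l := epoch N δ ((run ch δ x (n + 1)).count (upperItem k)) with hl
    have h2 : kLevel N δ L ≤ (run ch δ x (n + 1)).count (upperItem k) :=
      (kLevel_mono hN hδ hδ1 hL hle).trans (kLevel_epoch_le (by omega))
    have h3 := hmass (n + 1) hk h2
    have h4 : (run ch δ x n).newWidth ch δ (upperItem k) ≤ (1 / 2) ^ (l + 1) := by
      rw [State.newWidth, ← hcount]
      exact sqrt_log_beta_div_kLevel_le hN hδ hδ1 (hL.trans hle)
    rw [← hcount] at h1
    have hC : (0 : ℝ) < (run ch δ x (n + 1)).count (upperItem k) := by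
      have := (hL.trans (self_le_kLevel hN hδ hδ1 L)).trans h2
      exact_mod_cast this
    set C : ℝ := ((run ch δ x (n + 1)).count (upperItem k) : ℝ)
    have h5 : gap u k * (ρ * C) ≤ 4 * (1 / 2) ^ (l + 1) * C :=
      (mul_le_mul_of_nonneg_left h3 hgap.le).trans (h1.trans (by gcongr))
    have h6 : gap u k * ρ ≤ 4 * (1 / 2) ^ (l + 1) := by
      rw [← mul_assoc] at h5
      exact le_of_mul_le_mul_right h5 hC
    have h7 : (2 : ℝ) ^ L ≤ 2 ^ l := pow_le_pow_right₀ (by norm_num) hle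
    have hρ0 : 0 < ρ * gap u k := by
      by_contra! hneg
      have := mul_nonpos_of_nonpos_of_nonneg hneg (pow_nonneg zero_le_two L : (0 : ℝ) ≤ 2 ^ L)
      linarith
    have h8 : ρ * gap u k * 2 ^ l ≤ 2 := by
      calc ρ * gap u k * 2 ^ l ≤ 4 * (1 / 2) ^ (l + 1) * 2 ^ l := by
            rw [mul_comm ρ]; gcongr
        _ = 2 * ((1 / 2) ^ l * 2 ^ l) := by ring
        _ = 2 := by rw [← mul_pow]; norm_num
    have h9 : ρ * gap u k * 2 ^ L ≤ ρ * gap u k * 2 ^ l := by gcongr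
    linarith

lemma count_lt_of_unsplit {k : Fin (N - 1)} (hgap : 0 < gap u k) {L : ℕ} (hL : 1 ≤ L) {ρ : ℝ}
    (hρ : 2 < ρ * gap u k * 2 ^ L)
    (hmass : ∀ n, (run ch δ x n).Unsplit k →
      kLevel N δ L ≤ (run ch δ x n).count (upperItem k) →
      ρ * (run ch δ x n).count (upperItem k) ≤ mass u ch δ x n (upperItem k) (lowerItem k))
    (n : ℕ) (hk : (run ch δ x n).Unsplit k) :
    (run ch δ x n).count (upperItem k) < kLevel N δ L := by
  by_contra! hle
  have := epoch_lt_of_unsplit hu hI hN hδ hδ1 hpos hc hgap hL hρ hmass n hk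
  exact absurd (le_epoch hN hδ hδ1 hle) (not_le.2 this)

end Progress

section Pairing

/-- The map exchanging `2k` and `2k+1`. -/
def pairSwap (i : ℕ) : ℕ := if i % 2 = 0 then i + 1 else i - 1

lemma pairSwap_eq_iff (i j : ℕ) : pairSwap i = j ↔ i ≠ j ∧ i / 2 = j / 2 := by
  unfold pairSwap
  split_ifs <;> omega

lemma sum_mul_partner_le_sum_mul_pairSwap (v : ℕ → ℝ) (hv : Antitone v) (n : ℕ) (m : ℕ → ℕ)
    (hlt : ∀ i < 2 * n, m i < 2 * n) (hinv : ∀ i < 2 * n, m (m i) = i)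
    (hne : ∀ i < 2 * n, m i ≠ i) :
    ∑ i ∈ Finset.range (2 * n), v i * v (m i) ≤
      ∑ i ∈ Finset.range (2 * n), v i * v (pairSwap i) := by
  induction n generalizing m with
  | zero => simp
  | succ n ih =>
    have hc : 2 * (n + 1) = 2 * n + 1 + 1 := by ring
    have hs : pairSwap (2 * n) = 2 * n + 1 := by rw [pairSwap_eq_iff]; omega
    have hs' : pairSwap (2 * n + 1) = 2 * n := by rw [pairSwap_eq_iff]; omega
    rw [hc, Finset.sum_range_succ, Finset.sum_range_succ, Finset.sum_range_succ,
      Finset.sum_range_succ, hs, hs']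
    set a := m (2 * n + 1) with ha
    set b := m (2 * n) with hb
    have hma : m a = 2 * n + 1 := hinv _ (by omega)
    have hmb : m b = 2 * n := hinv _ (by omega)
    have hne1 := hne (2 * n + 1) (by omega)
    have hne2 := hne (2 * n) (by omega)
    have hlt1 := hlt (2 * n + 1) (by omega)
    have hlt2 := hlt (2 * n) (by omega)
    rw [← ha] at hne1 hlt1
    rw [← hb] at hne2 hlt2
    by_cases hcase : a = 2 * n
    · have hb' : b = 2 * n + 1 := by rw [← hma, hcase]
      have := ih m (fun i hi => ?_) (fun i hi => hinv i (by omega)) (fun i hi => hne i (by omega))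
      · rw [hcase, hb']
        linarith
      · have h1 := hlt i (by omega)
        have h2 := hinv i (by omega)
        by_contra! h3
        rcases (show m i = 2 * n ∨ m i = 2 * n + 1 by omega) with h4 | h4
        · rw [h4, ← hb] at h2; omega
        · rw [h4, ← ha] at h2; omega
    · have ha2 : a < 2 * n := by omega
      have hb1 : b ≠ 2 * n + 1 := by
        intro h
        rw [h, ← ha] at hmb
        exact hcase hmb
      have hb2 : b < 2 * n := by omega
      have hab : a ≠ b := by
        intro h
        rw [h, hmb] at hma
        omega
      let m' : ℕ → ℕ := fun i => if i = a then b else if i = b then a else m i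
      have hm'a : m' a = b := by simp [m']
      have hm'b : m' b = a := by simp [m', hab.symm]
      have hm'o : ∀ i, i ≠ a → i ≠ b → m' i = m i := fun i h1 h2 => by simp [m', h1, h2]
      have hout : ∀ i < 2 * n, i ≠ a → i ≠ b → m i < 2 * n ∧ m i ≠ a ∧ m i ≠ b := by
        intro i hi h1 h2
        have h3 := hlt i (by omega)
        have h4 := hinv i (by omega)
        refine ⟨?_, ?_, ?_⟩
        · by_contra! h5
          rcases (show m i = 2 * n ∨ m i = 2 * n + 1 by omega) with h6 | h6
          · rw [h6, ← hb] at h4; omega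
          · rw [h6, ← ha] at h4; omega
        · intro h5; rw [h5, hma] at h4; omega
        · intro h5; rw [h5, hmb] at h4; omega
      have key := ih m' ?_ ?_ ?_
      · have hdiff : ∑ i ∈ Finset.range (2 * n), v i * v (m' i) =
            ∑ i ∈ Finset.range (2 * n), v i * v (m i) +
              (v a * (v b - v (2 * n + 1)) + v b * (v a - v (2 * n))) := by
          rw [← sub_eq_iff_eq_add', ← Finset.sum_sub_distrib,
            ← Finset.sum_subset (s₁ := {a, b}) (by
              intro i hi
              simp only [Finset.mem_insert, Finset.mem_singleton] at hi
              rw [Finset.mem_range]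
              omega) ?_, Finset.sum_pair hab, hm'a, hm'b, hma, hmb]
          · ring
          · intro i _ hi
            simp only [Finset.mem_insert, Finset.mem_singleton, not_or] at hi
            rw [hm'o i hi.1 hi.2, sub_self]
        have h1 : v (2 * n) ≤ v a := hv ha2.le
        have h2 : v (2 * n + 1) ≤ v b := hv (by omega)
        have h3 := mul_nonneg (sub_nonneg.2 h1) (sub_nonneg.2 h2)
        linarith
      · intro i hi
        by_cases h1 : i = a
        · rw [h1, hm'a]; exact hb2
        by_cases h2 : i = b
        · rw [h2, hm'b]; exact ha2
        rw [hm'o i h1 h2]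
        exact (hout i hi h1 h2).1
      · intro i hi
        by_cases h1 : i = a
        · rw [h1, hm'a, hm'b]
        by_cases h2 : i = b
        · rw [h2, hm'b, hm'a]
        obtain ⟨-, h3, h4⟩ := hout i hi h1 h2
        rw [hm'o i h1 h2, hm'o _ h3 h4]
        exact hinv i (by omega)
      · intro i hi
        by_cases h1 : i = a
        · rw [h1, hm'a]; exact hab.symm
        by_cases h2 : i = b
        · rw [h2, hm'b]; exact hab
        rw [hm'o i h1 h2]
        exact hne i (by omega)

variable {N : ℕ} {u : Item N → ℝ}

/-- The matching of the items `2k-1` and `2k` (1-based). -/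
def sortedMatching (N : ℕ) (i : Item N) : Item N :=
  ⟨pairSwap i, by have := i.2; unfold pairSwap; split_ifs <;> omega⟩

lemma sortedMatching_eq_iff {i j : Item N} :
    sortedMatching N i = j ↔ i ≠ j ∧ (i : ℕ) / 2 = (j : ℕ) / 2 := by
  rw [Fin.ext_iff, Ne, Fin.ext_iff]
  exact pairSwap_eq_iff i j

lemma isOptimalMatching_sortedMatching (hu : Antitone u) :
    IsOptimalMatching u (sortedMatching N) := by
  refine ⟨⟨fun i => ?_, fun i h => (sortedMatching_eq_iff.1 h).1 rfl⟩, fun m hm => ?_⟩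
  · have h := sortedMatching_eq_iff.1 (rfl : sortedMatching N i = _)
    exact sortedMatching_eq_iff.2 ⟨h.1.symm, h.2.symm⟩
  · rcases Nat.eq_zero_or_pos N with rfl | hN
    · exact le_of_eq (Finset.sum_congr rfl fun i _ => absurd i.2 (by omega))
    let v : ℕ → ℝ := fun i => u ⟨min i (2 * N - 1), by omega⟩
    have hv : Antitone v := fun i j hij => hu (Fin.mk_le_mk.2 (min_le_min_right _ hij))
    have hvu : ∀ i : Item N, v i = u i := fun i => by
      have := i.2
      exact congrArg u (Fin.ext (min_eq_left (by omega)))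
    let m' : ℕ → ℕ := fun i => if h : i < 2 * N then (m ⟨i, h⟩ : ℕ) else i
    have hm' : ∀ i : Item N, m' i = (m i : ℕ) := fun i => by simp [m']
    have := sum_mul_partner_le_sum_mul_pairSwap v hv N m' (fun i hi => ?_) (fun i hi => ?_)
      (fun i hi => ?_)
    · rw [← Fin.sum_univ_eq_sum_range (fun i => v i * v (m' i)),
        ← Fin.sum_univ_eq_sum_range (fun i => v i * v (pairSwap i))] at this
      refine le_of_eq_of_le ?_ (this.trans_eq ?_)
      · exact Finset.sum_congr rfl fun i _ => by rw [hm', hvu, hvu]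
      · exact Finset.sum_congr rfl fun i _ => by
          rw [hvu, ← hvu (sortedMatching N i)]; rfl
    · rw [hm' ⟨i, hi⟩]; exact (m _).2
    · rw [hm' ⟨i, hi⟩, hm', hm.1]
    · rw [hm' ⟨i, hi⟩]
      exact fun h => hm.2 ⟨i, hi⟩ (Fin.ext h)

lemma State.Ordered.returns_sortedMatching {st : State N} (h : st.Ordered u) (hu : Antitone u)
    (h0 : st.unranked = ∅) : st.Returns (sortedMatching N) := by
  have hlev : ∀ i : Item N, st.level i / 2 = (i : ℕ) / 2 := by
    intro i
    have h1 := h.level_le hu i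
    rcases Nat.eq_zero_or_pos ((i : ℕ) / 2) with h2 | h2
    · omega
    · have hi := i.2
      have h3 := h.le_level_of_not_unsplit hu (k := ⟨(i : ℕ) / 2 - 1, by omega⟩) (fun hk => by
        have := h.upperItem_mem_unranked hu hk
        simp [h0] at this) (i := i) (by simp only; omega)
      simp only at h3
      omega
  intro i j
  rw [sortedMatching_eq_iff, hlev, hlev]

end Pairing

section Stopping

variable {N : ℕ} {u : Item N → ℝ} {ch : Choices N} {δ : ℝ} {x : Item N → Item N → ℕ → ℝ}

lemma State.one_le_rounds {st : State N} (ch : Choices N) (h : st.unranked.Nonempty) :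
    1 ≤ st.rounds ch := by
  have h1 : 0 < (st.active ch).card :=
    Finset.card_pos.2 (h.mono (Finset.subset_union_right.trans (st.union_subset_active ch)))
  obtain ⟨c, hc⟩ := st.even_card_active ch
  unfold State.rounds
  omega

lemma exists_unranked_eq_empty {T : ℕ}
    (h : ∀ n, (run ch δ x n).unranked.Nonempty → (run ch δ x n).time ≤ T) :
    ∃ n, (run ch δ x n).unranked = ∅ ∧ (run ch δ x n).time ≤ T + 2 * N := by
  classical
  have hex : ∃ n, (run ch δ x n).unranked = ∅ := by
    by_contra! hne
    have : ∀ n, n ≤ (run ch δ x n).time := by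
      intro n
      induction n with
      | zero => exact Nat.zero_le _
      | succ n ih =>
        rw [run, State.step_time _ _ _ _ (hne n)]
        have := State.one_le_rounds ch (hne n)
        omega
    have h1 := this (T + 1)
    have h2 := h (T + 1) (hne _)
    omega
  obtain ⟨hn, hmin⟩ := And.intro (Nat.find_spec hex) (fun m => Nat.find_min hex (m := m))
  refine ⟨Nat.find hex, hn, ?_⟩
  rcases hk : Nat.find hex with _ | m
  · exact Nat.zero_le _
  · have hm : (run ch δ x m).unranked.Nonempty :=
      Finset.nonempty_iff_ne_empty.2 (hmin m (by omega))
    rw [run, State.step_time _ _ _ _ hm]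
    have h1 := h m hm
    have h2 := (run ch δ x m).rounds_le ch
    omega

lemma identifiesWithin_of_count_lt (hu : Antitone u) (hI : ∀ n, Invariant u ch δ x n) {K : ℕ}
    (hK : ∀ n k, (run ch δ x n).Unsplit k → (run ch δ x n).count (upperItem k) < K) {b : ℝ}
    (hb : 4 * (K : ℝ) + 2 * N ≤ b) : IdentifiesWithin u ch δ x b := by
  obtain ⟨n, hn, ht⟩ := exists_unranked_eq_empty (ch := ch) (δ := δ) (x := x) (T := 4 * K) (by
    rintro n ⟨i, hi⟩
    obtain ⟨k, hk, -⟩ := (hI n).ordered.exists_unsplit hu hi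
    have h1 := time_le_of_unsplit hu hI hk
    have h2 := hK n k hk
    omega)
  refine ⟨n, hn, le_trans ?_ hb, sortedMatching N, (hI n).ordered.returns_sortedMatching hu hn,
    isOptimalMatching_sortedMatching hu⟩
  exact_mod_cast ht

end Stopping

variable {N : ℕ} {u : Item N → ℝ}

lemma muWithout_mul_card_le (hpos : ∀ i, 0 < u i) (k : Fin (N - 1)) {J : Finset (Item N)}
    (hJ : J ⊆ Finset.univ \ {upperItem k, lowerItem k})
    (hle : ∀ j ∈ J, ∀ i ∉ J, i ∉ ({upperItem k, lowerItem k} : Finset (Item N)) → u i ≤ u j) :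
    muWithout u k * J.card ≤ ∑ j ∈ J, u j := by
  have hN : (0 : ℝ) < 2 * N := by
    have := k.2
    have : 0 < N := by omega
    positivity
  set I := Finset.univ \ ({upperItem k, lowerItem k} : Finset (Item N)) with hI
  have h1 := Finset.sum_sdiff (f := u) hJ
  have h2 := Finset.card_sdiff_add_card_eq_card hJ
  have h3 : I.card ≤ 2 * N := by simpa using Finset.card_le_univ I
  have h4 : (J.card : ℝ) * ∑ i ∈ I \ J, u i ≤ ((I \ J).card : ℝ) * ∑ j ∈ J, u j := by
    have : ∑ j ∈ J, ∑ i ∈ I \ J, u i ≤ ∑ j ∈ J, ∑ i ∈ I \ J, u j := by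
      refine Finset.sum_le_sum fun j hj => Finset.sum_le_sum fun i hi => ?_
      rw [Finset.mem_sdiff, hI, Finset.mem_sdiff] at hi
      exact hle j hj i hi.2 hi.1.2
    simpa [← Finset.mul_sum] using this
  have h5 : (0 : ℝ) ≤ ∑ j ∈ J, u j := Finset.sum_nonneg fun j _ => (hpos j).le
  have h6 : (((I \ J).card : ℝ) + J.card) ≤ 2 * N := by exact_mod_cast h2.trans_le h3
  rw [muWithout, ← hI, ← h1, one_div, mul_assoc, inv_mul_le_iff₀ hN]
  nlinarith [mul_le_mul_of_nonneg_right h6 h5]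

lemma State.Ordered.muWithout_mul_card_erase_le {st : State N} (h : st.Ordered u)
    (hu : Antitone u) (hpos : ∀ i, 0 < u i) {k : Fin (N - 1)} (hk : st.Unsplit k) :
    muWithout u k / 2 * (st.candidates.erase (upperItem k)).card ≤
      ∑ b ∈ (st.candidates.erase (upperItem k)).erase (lowerItem k), u b := by
  have hμ : 0 ≤ muWithout u k :=
    mul_nonneg (by positivity) (Finset.sum_nonneg fun i _ => (hpos i).le)
  have h1 := muWithout_mul_card_le hpos k
    (J := (st.candidates.erase (upperItem k)).erase (lowerItem k)) (fun j hj => by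
      simp only [Finset.mem_erase] at hj
      simp [hj.1, hj.2.1]) (fun j hj i hi hik => by
      simp only [Finset.mem_erase, Finset.mem_insert, Finset.mem_singleton, not_or, not_and]
        at hj hi hik
      have hi' := hi hik.2 hik.1
      refine hu ?_
      by_contra! hlt
      exact hi' (h.mem_candidates_of_le hu hlt.le hj.2.2))
  have h2 : (st.candidates.erase (upperItem k)).card ≤
      2 * ((st.candidates.erase (upperItem k)).erase (lowerItem k)).card := by
    have hiff := State.candidates_congr hk
    by_cases hU : upperItem k ∈ st.candidates
    · have hL := hiff.1 hU
      have hk2 := k.2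
      have h0 : (⟨0, by omega⟩ : Item N) ∈ st.candidates :=
        h.mem_candidates_of_le hu (by simp [Fin.le_def]) hU
      have hne : lowerItem k ≠ upperItem k := by simp [upperItem, lowerItem, Fin.ext_iff]
      have h3 : 1 ≤ ((st.candidates.erase (upperItem k)).erase (lowerItem k)).card := by
        refine Finset.card_pos.2 ⟨⟨0, by omega⟩, ?_⟩
        simp [Finset.mem_erase, h0, upperItem, lowerItem, Fin.ext_iff]
      rw [Finset.card_erase_of_mem (Finset.mem_erase.2 ⟨hne, hL⟩)] at h3 ⊢
      omega
    · rw [Finset.erase_eq_of_notMem hU, Finset.erase_eq_of_notMem fun h' => hU (hiff.2 h')]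
      omega
  have h3 : ((st.candidates.erase (upperItem k)).card : ℝ) ≤
      2 * ((st.candidates.erase (upperItem k)).erase (lowerItem k)).card := by exact_mod_cast h2
  nlinarith [mul_le_mul_of_nonneg_left h3 hμ]

section LastSplit

variable {st : State N} {s : Fin (N - 1)}

lemma State.Ordered.card_unranked_le_four (h : st.Ordered u) (hu : Antitone u)
    (hs : st.Unsplit s) (hall : ∀ k, k ≠ s → ¬ st.Unsplit k) : st.unranked.card ≤ 4 := by
  have hsub : st.unranked.map Fin.valEmbedding ⊆
      Finset.Ico (2 * (s : ℕ)) (2 * (s : ℕ) + 4) := by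
    intro i' hi'
    obtain ⟨i, hi, rfl⟩ := Finset.mem_map.1 hi'
    obtain ⟨k, hk, hki⟩ := h.exists_unsplit hu hi
    have hks : k = s := by
      by_contra hne
      exact hall k hne hk
    subst hks
    rw [Finset.mem_Ico, Fin.valEmbedding_apply]
    by_contra hno
    rcases (show (i : ℕ) / 2 < (upperItem k : ℕ) / 2 ∨ (lowerItem k : ℕ) / 2 < (i : ℕ) / 2 by
      simp only [upperItem, lowerItem]; omega) with h1 | h1
    · obtain ⟨l, hl, -, hl'⟩ := h.unsplit_of_div_lt hu hki.symm h1
      refine hall l (fun hlk => ?_) hl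
      rw [hlk] at hl'
      simp only [upperItem] at h1
      omega
    · obtain ⟨l, hl, -, hl'⟩ := h.unsplit_of_div_lt hu (hs.symm.trans hki) h1
      refine hall l (fun hlk => ?_) hl
      rw [hlk] at hl'
      simp only [lowerItem] at hl'
      omega
  simpa using Finset.card_le_card hsub

lemma State.Ordered.card_candidates_le_six (h : st.Ordered u) (hu : Antitone u)
    (hs : st.Unsplit s) (hall : ∀ k, k ≠ s → ¬ st.Unsplit k) : st.candidates.card ≤ 6 := by
  have h4 := h.card_unranked_le_four hu hs hall
  have hsub : st.candidates.map Fin.valEmbedding ⊆ Finset.range 6 := by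
    intro i' hi'
    obtain ⟨i, hi, rfl⟩ := Finset.mem_map.1 hi'
    rw [State.mem_candidates] at hi
    rw [Finset.mem_range, Fin.valEmbedding_apply]
    by_contra! h6
    have hi2 := i.2
    by_cases hs1 : (s : ℕ) = 1
    · have := h.le_level_of_not_unsplit hu (k := ⟨2, by omega⟩)
        (hall _ fun h' => by rw [← h'] at hs1; simp at hs1) (i := i) (by simp only; omega)
      simp only at this
      omega
    · have := h.le_level_of_not_unsplit hu (k := ⟨1, by omega⟩)
        (hall _ fun h' => by rw [← h'] at hs1; simp at hs1) (i := i) (by simp only; omega)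
      simp only at this
      omega
  simpa using Finset.card_le_card hsub

lemma State.Ordered.add_le_sum_candidates (h : st.Ordered u) (hu : Antitone u)
    (hpos : ∀ i, 0 < u i) (hs : st.Unsplit s) (hs1 : 1 ≤ (s : ℕ)) (h0 : 0 < 2 * N)
    (h1 : 1 < 2 * N) : u ⟨0, h0⟩ + u ⟨1, h1⟩ ≤
      ∑ b ∈ (st.candidates.erase (upperItem s)).erase (lowerItem s), u b := by
  have h2 := State.two_le_card_unranked hs (h.upperItem_mem_unranked hu hs)
  rw [← Finset.sum_pair (show (⟨0, h0⟩ : Item N) ≠ ⟨1, h1⟩ by simp)]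
  refine Finset.sum_le_sum_of_subset_of_nonneg (fun j hj => ?_) fun b _ _ => (hpos b).le
  have hj1 : (j : ℕ) ≤ 1 := by
    rcases Finset.mem_insert.1 hj with rfl | hj
    · simp
    · rw [Finset.mem_singleton.1 hj]
  refine Finset.mem_erase.2 ⟨?_, Finset.mem_erase.2 ⟨?_, h.mem_candidates_of_lt hu (by omega)⟩⟩
  · simp only [lowerItem, Ne, Fin.ext_iff]; omega
  · simp only [upperItem, Ne, Fin.ext_iff]; omega

end LastSplit

section Mass

variable {ch : Choices N} {δ : ℝ} {x : Item N → Item N → ℕ → ℝ}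
  (hu : Antitone u) (hpos : ∀ i, 0 < u i) (hI : ∀ n, Invariant u ch δ x n)
include hu hpos hI

lemma muWithout_mul_count_le_mass {n : ℕ} {k : Fin (N - 1)} (hk : (run ch δ x n).Unsplit k) :
    muWithout u k / 2 * (run ch δ x n).count (upperItem k) ≤
      mass u ch δ x n (upperItem k) (lowerItem k) := by
  induction n with
  | zero => simp [run, State.init, mass]
  | succ n ih =>
    have hk' := unsplit_of_succ hI hk
    rw [count_succ_of_unsplit hu hI hk', mass_succ_of_unsplit hu hI hk', Nat.cast_add, mul_add]
    exact add_le_add (ih hk') ((hI n).ordered.muWithout_mul_card_erase_le hu hpos hk')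

lemma add_mul_count_le_mass_add {s : Fin (N - 1)} (hs1 : 1 ≤ (s : ℕ)) (h0 : 0 < 2 * N)
    (h1 : 1 < 2 * N) {K : ℕ} (hK : ∀ n k, k ≠ s → (run ch δ x n).Unsplit k →
      (run ch δ x n).count (upperItem k) < K) {n : ℕ} (hs : (run ch δ x n).Unsplit s) :
    (u ⟨0, h0⟩ + u ⟨1, h1⟩) / 6 * (run ch δ x n).count (upperItem s) ≤
      mass u ch δ x n (upperItem s) (lowerItem s) +
        (u ⟨0, h0⟩ + u ⟨1, h1⟩) / 6 * (2 * K + 2 * N : ℕ) := by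
  have hq : 0 ≤ (u ⟨0, h0⟩ + u ⟨1, h1⟩) / 6 := by
    have := hpos ⟨0, h0⟩
    have := hpos ⟨1, h1⟩
    positivity
  set q := (u ⟨0, h0⟩ + u ⟨1, h1⟩) / 6 with hqdef
  induction n with
  | zero => simp only [run, State.init, mass, Nat.cast_zero, mul_zero, zero_add]; positivity
  | succ n ih =>
    have hs' := unsplit_of_succ hI hs
    have ho := (hI n).ordered
    by_cases hall : ∀ k, k ≠ s → ¬ (run ch δ x n).Unsplit k
    · rw [count_succ_of_unsplit hu hI hs', mass_succ_of_unsplit hu hI hs', Nat.cast_add, mul_add]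
      have h2 := ih hs'
      have h3 := ho.add_le_sum_candidates hu hpos hs' hs1 h0 h1
      have h4 : (((run ch δ x n).candidates.erase (upperItem s)).card : ℝ) ≤ 6 := by
        exact_mod_cast Finset.card_erase_le.trans (ho.card_candidates_le_six hu hs' hall)
      have h5 := mul_le_mul_of_nonneg_left h4 hq
      linarith
    · push Not at hall
      obtain ⟨k, hks, hk⟩ := hall
      have h2 := count_le_two_mul_count hu hI hs' hk
      have h3 := hK n k hks hk
      have h4 : ((run ch δ x n).candidates.erase (upperItem s)).card ≤ 2 * N := by
        simpa using Finset.card_le_univ ((run ch δ x n).candidates.erase (upperItem s))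
      have h5 : (run ch δ x (n + 1)).count (upperItem s) ≤ 2 * K + 2 * N := by
        rw [count_succ_of_unsplit hu hI hs']
        omega
      have h6 : ((run ch δ x (n + 1)).count (upperItem s) : ℝ) ≤ (2 * K + 2 * N : ℕ) := by
        exact_mod_cast h5
      have h7 := mass_nonneg (ch := ch) (δ := δ) (x := x) hpos (n + 1) (upperItem s) (lowerItem s)
      have h8 := mul_le_mul_of_nonneg_left h6 hq
      linarith

end Mass

lemma sub_one_mul_gap_lt_one (hN : 2 ≤ N) (h01 : ∀ i, 0 < u i ∧ u i < 1) (hu : Antitone u)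
    {s : Fin (N - 1)} (hs : ∀ k, gap u s ≤ gap u k) : ((N : ℝ) - 1) * gap u s < 1 := by
  have key : ∀ j, (hj : j < N - 1) →
      u ⟨2 * j + 2, by omega⟩ ≤ 1 - ((j : ℝ) + 1) * gap u s := by
    intro j
    induction j with
    | zero =>
      intro hj
      have h1 := hs ⟨0, hj⟩
      have h2 : gap u ⟨0, hj⟩ = u ⟨2 * 0 + 1, by omega⟩ - u ⟨2 * 0 + 2, by omega⟩ := rfl
      have h3 := (h01 ⟨2 * 0 + 1, by omega⟩).2
      push_cast
      linarith
    | succ j ih =>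
      intro hj
      have h1 := hs ⟨j + 1, hj⟩
      have h2 : gap u ⟨j + 1, hj⟩ =
        u ⟨2 * (j + 1) + 1, by omega⟩ - u ⟨2 * (j + 1) + 2, by omega⟩ := rfl
      have h3 : u ⟨2 * (j + 1) + 1, by omega⟩ ≤ u ⟨2 * j + 2, by omega⟩ :=
        hu (Fin.mk_le_mk.2 (by omega))
      have h4 := ih (by omega)
      push_cast
      linarith
  have h1 := key (N - 2) (by omega)
  have h2 := (h01 ⟨2 * (N - 2) + 2, by omega⟩).1
  rw [Nat.cast_sub hN] at h1
  push_cast at h1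
  nlinarith

section Deterministic

variable {N : ℕ} {u : Item N → ℝ} {ch : Choices N} {δ : ℝ} {x : Item N → Item N → ℕ → ℝ}
  (hN : 2 ≤ N) (hδ : 0 < δ) (hδ1 : δ < 1) (h01 : ∀ i, 0 < u i ∧ u i < 1) (hu : Antitone u)
  (hgap : ∀ k, 0 < gap u k) (hc : Concentrates u ch δ x)
include hN hδ hδ1 h01 hu hgap hc

lemma count_lt_of_four_lt {k : Fin (N - 1)} {L : ℕ} (hL : 1 ≤ L)
    (hk : 4 < muWithout u k * gap u k * 2 ^ L) (n : ℕ) (hn : (run ch δ x n).Unsplit k) :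
    (run ch δ x n).count (upperItem k) < kLevel N δ L := by
  have hpos := fun i => (h01 i).1
  have hI := hc.invariant hN hδ hδ1 hpos
  exact count_lt_of_unsplit hu hI hN hδ hδ1 hpos hc (hgap k) hL (ρ := muWithout u k / 2)
    (by linarith) (fun n hn _ => muWithout_mul_count_le_mass hu hpos hI hn) n hn

lemma identifiesWithin_of_four_lt {L : ℕ} (hL : 1 ≤ L)
    (hk : ∀ k, 4 < muWithout u k * gap u k * 2 ^ L) :
    IdentifiesWithin u ch δ x (4 * kLevel N δ L + 2 * N) :=
  identifiesWithin_of_count_lt hu (hc.invariant hN hδ hδ1 fun i => (h01 i).1)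
    (fun n k hn => count_lt_of_four_lt hN hδ hδ1 h01 hu hgap hc hL (hk k) n hn) le_rfl

lemma identifiesWithin_of_eight_lt (hp0 : 0 < 2 * N) (hp1 : 1 < 2 * N) {s : Fin (N - 1)}
    (hs1 : 1 ≤ (s : ℕ)) (hs : ∀ k, gap u s ≤ gap u k) {q : ℝ}
    (hq : q = (u ⟨0, hp0⟩ + u ⟨1, hp1⟩) * gap u s)
    (hk : ∀ k, k ≠ s → q / 2 ≤ muWithout u k * gap u k) {L : ℕ} (hL : 1 ≤ L)
    (hqL : 8 < q * 2 ^ L) :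
    IdentifiesWithin u ch δ x (4 * kLevel N δ (L + 3) + 2 * N) := by
  have hpos := fun i => (h01 i).1
  have hI := hc.invariant hN hδ hδ1 hpos
  have h2L : (0 : ℝ) < 2 ^ L := by positivity
  have hK : ∀ n k, k ≠ s → (run ch δ x n).Unsplit k →
      (run ch δ x n).count (upperItem k) < kLevel N δ L := fun n k hks hn =>
    count_lt_of_four_lt hN hδ hδ1 h01 hu hgap hc hL
      (by nlinarith [mul_le_mul_of_nonneg_right (hk k hks) h2L.le]) n hn
  have hk4 : 4 * kLevel N δ L + 4 * N ≤ kLevel N δ (L + 3) := by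
    have h1 : 64 * ((kLevel N δ L : ℝ) - 1) ≤ kLevel N δ (L + 3) := by
      have h2 : (kLevel N δ L : ℝ) - 1 ≤ 4 ^ (L + 1) * Real.log (beta N δ L) := by
        have := Nat.ceil_lt_add_one (a := (4 : ℝ) ^ (L + 1) * Real.log (beta N δ L))
          (mul_nonneg (by positivity) (by linarith [one_le_log_beta hN hδ hδ1 hL]))
        rw [kLevel]
        linarith
      have h3 := le_kLevel (N := N) (δ := δ) (L + 3)
      have h4 := log_beta_mono hN hδ hδ1 hL (show L ≤ L + 3 by omega)
      have h5 : (4 : ℝ) ^ (L + 1) * Real.log (beta N δ L) ≤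
          4 ^ (L + 1) * Real.log (beta N δ (L + 3)) := by gcongr
      have h6 : (4 : ℝ) ^ (L + 3 + 1) = 64 * 4 ^ (L + 1) := by ring
      rw [h6] at h3
      linarith
    have hN' : (2 : ℝ) ≤ N := by exact_mod_cast hN
    have h7 : 4 * ((N : ℝ) - 1) < 2 ^ L := by
      have h8 := sub_one_mul_gap_lt_one hN h01 hu hs
      have h9 : q ≤ 2 * gap u s := by
        rw [hq]
        have := (h01 ⟨0, hp0⟩).2
        have := (h01 ⟨1, hp1⟩).2
        exact mul_le_mul_of_nonneg_right (by linarith) (hgap s).le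
      have h10 : 4 < gap u s * 2 ^ L := by nlinarith
      have h11 : ((N : ℝ) - 1) * gap u s * 2 ^ L < 2 ^ L := by
        nlinarith
      nlinarith
    have h8 : (4 : ℝ) * (2 ^ L) ^ 2 ≤ kLevel N δ L := by
      have := four_pow_le_kLevel hN hδ hδ1 hL
      have h9 : (4 : ℝ) * (2 ^ L) ^ 2 = ((4 ^ (L + 1) : ℕ) : ℝ) := by
        push_cast
        rw [← pow_mul, mul_comm L 2, pow_mul, pow_succ]
        norm_num
        ring
      rw [h9]
      exact_mod_cast this
    have h9 : 64 * ((N : ℝ) - 1) ^ 2 ≤ kLevel N δ L := by nlinarith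
    have h10 : (4 : ℝ) * kLevel N δ L + 4 * N ≤ kLevel N δ (L + 3) := by nlinarith
    exact_mod_cast h10
  refine identifiesWithin_of_count_lt hu hI (fun n k hn => ?_) le_rfl
  by_cases hks : k = s
  · subst hks
    refine count_lt_of_unsplit hu hI hN hδ hδ1 hpos hc (hgap k) (by omega)
      (ρ := (u ⟨0, hp0⟩ + u ⟨1, hp1⟩) / 12) ?_ (fun n hn hcount => ?_) n hn
    · have : (2 : ℝ) ^ (L + 3) = 8 * 2 ^ L := by ring
      rw [this]
      rw [hq] at hqL
      linarith
    · have h1 := add_mul_count_le_mass_add hu hpos hI hs1 hp0 hp1 hK hn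
      have h2 : ((2 * (2 * kLevel N δ L + 2 * N) : ℕ) : ℝ) ≤
          (run ch δ x n).count (upperItem k) := by
        exact_mod_cast (by omega : 2 * (2 * kLevel N δ L + 2 * N) ≤ kLevel N δ (L + 3)).trans hcount
      rw [Nat.cast_mul, Nat.cast_two] at h2
      have h3 : 0 ≤ u ⟨0, hp0⟩ + u ⟨1, hp1⟩ := (add_pos (hpos _) (hpos _)).le
      have h4 := mul_le_mul_of_nonneg_left h2 h3
      linarith
  · exact (hK n k hks hn).trans_le (kLevel_mono hN hδ hδ1 hL (by omega))

end Deterministic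

lemma four_mul_kLevel_add_le {N : ℕ} {δ : ℝ} (hN : 2 ≤ N) (hδ : 0 < δ) (hδ1 : δ < 1) {L : ℕ}
    (hL : 1 ≤ L) : 4 * (kLevel N δ L : ℝ) + 2 * N ≤ 8 * (2 ^ L) ^ 2 * Real.log (1 / δ) +
      (16 * (2 ^ L) ^ 2 * Real.log (Real.pi * Real.sqrt (2 * (N : ℝ) / 3) * L) + 4 + 2 * N) := by
  have h1 := Nat.ceil_lt_add_one (a := (4 : ℝ) ^ (L + 1) * Real.log (beta N δ L))
    (mul_nonneg (by positivity) (by linarith [one_le_log_beta hN hδ hδ1 hL]))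
  have hL' : (0 : ℝ) < L := by exact_mod_cast hL
  have hN' : (0 : ℝ) < N := by exact_mod_cast (by omega : 0 < N)
  have h2 : Real.log (beta N δ L) =
      Real.log (Real.pi * Real.sqrt (2 * (N : ℝ) / 3) * L) + 1 / 2 * Real.log (1 / δ) := by
    have h3 : beta N δ L = (Real.pi * Real.sqrt (2 * (N : ℝ) / 3) * L) * Real.sqrt (1 / δ) := by
      rw [beta, show 2 * (N : ℝ) / (3 * δ) = 2 * (N : ℝ) / 3 * (1 / δ) by field_simp,
        Real.sqrt_mul (by positivity)]
      ring
    have hpi := Real.pi_pos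
    have hp : 0 < Real.pi * Real.sqrt (2 * (N : ℝ) / 3) * L := by positivity
    have hs : 0 < Real.sqrt (1 / δ) := by positivity
    rw [h3, Real.log_mul hp.ne' hs.ne', Real.log_sqrt (by positivity)]
    ring
  have h4 : (4 : ℝ) ^ (L + 1) = 4 * (2 ^ L) ^ 2 := by
    rw [← pow_mul, mul_comm L 2, pow_mul, pow_succ]
    norm_num
    ring
  rw [h2, h4] at h1
  rw [kLevel, h2, h4]
  linarith

lemma exists_pow_two_near {r : ℝ} (hr : 1 ≤ r) : ∃ L : ℕ, 1 ≤ L ∧ r < 2 ^ L ∧ 2 ^ L ≤ 2 * r := by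
  obtain ⟨n, h1, h2⟩ := exists_nat_pow_near hr (one_lt_two : (1 : ℝ) < 2)
  exact ⟨n + 1, by omega, h2, by rw [pow_succ]; linarith⟩

lemma muWithout_pos {N : ℕ} {u : Item N → ℝ} (hpos : ∀ i, 0 < u i) (k : Fin (N - 1)) :
    0 < muWithout u k := by
  have hk := k.2
  have hN : (0 : ℝ) < N := by exact_mod_cast (by omega : 0 < N)
  refine mul_pos (by positivity) (Finset.sum_pos (fun i _ => hpos i) ⟨⟨0, by omega⟩, ?_⟩)
  simp [upperItem, lowerItem, Fin.ext_iff]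

lemma muWithout_mul_gap_le_one {N : ℕ} {u : Item N → ℝ} (h01 : ∀ i, 0 < u i ∧ u i < 1)
    (hgap : ∀ k, 0 < gap u k) (k : Fin (N - 1)) : muWithout u k * gap u k ≤ 1 := by
  have hk := k.2
  have hN : (0 : ℝ) < 2 * N := by
    have : (0 : ℝ) < N := by exact_mod_cast (by omega : 0 < N)
    linarith
  have h1 : muWithout u k ≤ 1 := by
    rw [muWithout, one_div, inv_mul_le_iff₀ hN, mul_one]
    calc _ ≤ ∑ i ∈ (Finset.univ : Finset (Item N)) \ {upperItem k, lowerItem k}, (1 : ℝ) :=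
          Finset.sum_le_sum fun i _ => (h01 i).2.le
      _ ≤ ∑ i : Item N, (1 : ℝ) :=
          Finset.sum_le_sum_of_subset_of_nonneg (Finset.subset_univ _) fun _ _ _ => zero_le_one
      _ = 2 * N := by simp
  have h2 : gap u k ≤ 1 := by
    have := (h01 (upperItem k)).2
    have := (h01 (lowerItem k)).1
    unfold gap
    linarith
  exact mul_le_one₀ h1 (hgap k).le h2

noncomputable section

variable {N : ℕ}

/-- Realizations of the noise. -/
abbrev NoisePath (N : ℕ) : Type := Sym2 (Item N) → ℕ → ℝ

/-- The observations for a given realization of the noise. -/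
def pathObservation (u : Item N → ℝ) (y : NoisePath N) (i j : Item N) (t : ℕ) : ℝ :=
  u i * u j + y s(i, j) t

/-- The discrete part of a state. -/
def State.config (st : State N) : ℕ × (Item N → ℕ) × (Item N → Finset (Item N)) :=
  (st.time, st.count, st.above)

/-- The state `st` with its discrete part replaced. -/
def State.withConfig (c : ℕ × (Item N → ℕ) × (Item N → Finset (Item N))) (st : State N) :
    State N :=
  { st with time := c.1, count := c.2.1, above := c.2.2 }

/-- The sum of the noise variables which are recorded for item `i` in the next iteration. -/
def State.noiseIncrement (st : State N) (ch : Choices N) (y : NoisePath N) (i : Item N) : ℝ :=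
  ∑ r ∈ st.recorded ch i, y s(i, st.partner ch r i) (st.time + r)

/-- The state after `n` iterations for a given realization of the noise. -/
def pathRun (u : Item N → ℝ) (ch : Choices N) (δ : ℝ) (n : ℕ) (y : NoisePath N) : State N :=
  run ch δ (pathObservation u y) n

lemma pathRun_succ (u : Item N → ℝ) (ch : Choices N) (δ : ℝ) (n : ℕ) (y : NoisePath N) :
    pathRun u ch δ (n + 1) y = (pathRun u ch δ n y).step ch δ (pathObservation u y) := rfl

section Measurability

lemma measurableSet_of_countable {α C : Type*} [MeasurableSpace α] [Countable C] {D : α → C}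
    (hD : ∀ c, MeasurableSet {y | D y = c}) {P : C → α → Prop}
    (hP : ∀ c, MeasurableSet {y | P c y}) : MeasurableSet {y | P (D y) y} := by
  have : {y | P (D y) y} = ⋃ c, {y | D y = c} ∩ {y | P c y} := by
    ext y
    simp
  rw [this]
  exact MeasurableSet.iUnion fun c => (hD c).inter (hP c)

lemma measurable_of_countable_config {α C E : Type*} [MeasurableSpace α] [MeasurableSpace E]
    [Countable C] {D : α → C} (hD : ∀ c, MeasurableSet {y | D y = c}) {F : C → α → E}
    (hF : ∀ c, Measurable (F c)) : Measurable fun y => F (D y) y := fun s hs =>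
  measurableSet_of_countable hD (P := fun c y => F c y ∈ s) fun c => hF c hs

/-- A state depending measurably on the noise. -/
structure MeasurableState (S : NoisePath N → State N) : Prop where
  config : ∀ c, MeasurableSet {y | (S y).config = c}
  total : ∀ i, Measurable fun y => (S y).total i
  lo : ∀ i, Measurable fun y => (S y).lo i
  hi : ∀ i, Measurable fun y => (S y).hi i

variable {u : Item N → ℝ} {ch : Choices N} {δ : ℝ} {S : NoisePath N → State N}

lemma measurable_noiseIncrement (st : State N) (i : Item N) :
    Measurable fun y : NoisePath N => st.noiseIncrement ch y i := by
  unfold State.noiseIncrement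
  fun_prop

lemma MeasurableState.step (hS : MeasurableState S) :
    MeasurableState fun y => (S y).step ch δ (pathObservation u y) := by
  have key : ∀ c, (∀ i, Measurable fun y =>
        (State.withConfig c (S y)).newTotal ch (pathObservation u y) i) ∧
      (∀ i, Measurable fun y => (State.withConfig c (S y)).newLo ch δ (pathObservation u y) i) ∧
      (∀ i, Measurable fun y => (State.withConfig c (S y)).newHi ch δ (pathObservation u y) i) := by
    intro c
    have h1 : ∀ i, Measurable fun y =>
        (State.withConfig c (S y)).newTotal ch (pathObservation u y) i := by
      intro i
      change Measurable fun y : NoisePath N => (S y).total i +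
        ∑ r ∈ (State.withConfig c (State.init N)).recorded ch i,
          (u i * u ((State.withConfig c (State.init N)).partner ch r i) +
            y s(i, (State.withConfig c (State.init N)).partner ch r i) (c.1 + r))
      have := hS.total i
      fun_prop
    have h2 : ∀ i, Measurable fun y =>
        (State.withConfig c (S y)).newMean ch (pathObservation u y) i := fun i =>
      (h1 i).div_const (((State.withConfig c (State.init N)).newCount ch i : ℕ) : ℝ)
    refine ⟨h1, fun i => ?_, fun i => ?_⟩
    · by_cases hup : (State.withConfig c (State.init N)).Updates ch δ i
      · have h3 : (fun y => (State.withConfig c (S y)).newLo ch δ (pathObservation u y) i) =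
            fun y => (((State.withConfig c (S y)).newMean ch (pathObservation u y) i -
              (State.withConfig c (State.init N)).newWidth ch δ i : ℝ) : EReal) := by
          funext y
          exact if_pos hup
        rw [h3]
        exact ((h2 i).sub_const _).coe_real_ereal
      · have h3 : (fun y => (State.withConfig c (S y)).newLo ch δ (pathObservation u y) i) =
            fun y => (S y).lo i := by
          funext y
          exact if_neg hup
        rw [h3]
        exact hS.lo i
    · by_cases hup : (State.withConfig c (State.init N)).Updates ch δ i
      · have h3 : (fun y => (State.withConfig c (S y)).newHi ch δ (pathObservation u y) i) =
            fun y => (((State.withConfig c (S y)).newMean ch (pathObservation u y) i +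
              (State.withConfig c (State.init N)).newWidth ch δ i : ℝ) : EReal) := by
          funext y
          exact if_pos hup
        rw [h3]
        exact ((h2 i).add_const _).coe_real_ereal
      · have h3 : (fun y => (State.withConfig c (S y)).newHi ch δ (pathObservation u y) i) =
            fun y => (S y).hi i := by
          funext y
          exact if_neg hup
        rw [h3]
        exact hS.hi i
  refine ⟨fun c' => ?_, fun i => ?_, fun i => ?_, fun i => ?_⟩
  · refine measurableSet_of_countable hS.config (P := fun c y =>
      ((State.withConfig c (S y)).step ch δ (pathObservation u y)).config = c') fun c => ?_
    by_cases h0 : (State.withConfig c (State.init N)).unranked = ∅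
    · have h1 : ∀ y, ((State.withConfig c (S y)).step ch δ (pathObservation u y)).config = c :=
        fun y => by
          rw [State.step_of_eq_empty (State.withConfig c (S y)) _ _ _ h0]
          rfl
      simp only [h1]
      exact MeasurableSet.const _
    · set σ := State.withConfig c (State.init N) with hσ
      have h1 : ∀ y, ((State.withConfig c (S y)).step ch δ (pathObservation u y)).config =
          (c.1 + σ.rounds ch, σ.newCount ch, σ.newAbove
            ((State.withConfig c (S y)).newLo ch δ (pathObservation u y))
            ((State.withConfig c (S y)).newHi ch δ (pathObservation u y))) := fun y => by
        have h2 : ¬ (State.withConfig c (S y)).unranked = ∅ := h0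
        unfold State.step
        rw [if_neg h2]
        rfl
      simp only [h1, Prod.ext_iff, funext_iff, Finset.ext_iff]
      rw [measurableSet_setOfPred]
      refine measurable_const.and (measurable_const.and (Measurable.forall fun i =>
        Measurable.forall fun j => Measurable.iff ?_ measurable_const))
      simp only [State.newAbove, Finset.mem_union, Finset.mem_filter, Finset.mem_univ, true_and]
      refine measurable_const.or (Measurable.exists fun V => measurable_const.and
        (measurable_const.and (measurable_const.and (Measurable.forall fun v =>
          measurable_const.imp (Measurable.forall fun k => measurable_const.imp ?_)))))
      exact measurableSet_setOfPred.1 (measurableSet_lt ((key c).2.2 k) ((key c).2.1 v))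
  · simp only [State.step_total]
    exact measurable_of_countable_config hS.config fun c => (key c).1 i
  · simp only [State.step_lo]
    exact measurable_of_countable_config hS.config fun c => (key c).2.1 i
  · simp only [State.step_hi]
    exact measurable_of_countable_config hS.config fun c => (key c).2.2 i

lemma measurableState_pathRun (n : ℕ) : MeasurableState (pathRun u ch δ n) := by
  induction n with
  | zero =>
    refine ⟨fun c => MeasurableSet.const ((State.init N).config = c), fun i => measurable_const, fun i => measurable_const,
      fun i => measurable_const⟩
  | succ n ih => exact ih.step

end Measurability

section Dependence

variable {u : Item N → ℝ} {ch : Choices N} {δ : ℝ}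

lemma State.noiseIncrement_congr (st : State N) {y y' : NoisePath N}
    (h : ∀ e, ∀ t < st.time + st.rounds ch, y' e t = y e t) (i : Item N) :
    st.noiseIncrement ch y' i = st.noiseIncrement ch y i := by
  refine Finset.sum_congr rfl fun r hr => h _ _ ?_
  simp only [State.recorded, Finset.mem_filter, Finset.mem_range] at hr
  omega

lemma State.step_congr (st : State N) {y y' : NoisePath N}
    (h : ∀ e, ∀ t < (st.step ch δ (pathObservation u y)).time, y' e t = y e t) :
    st.step ch δ (pathObservation u y') = st.step ch δ (pathObservation u y) := by
  rcases st.unranked.eq_empty_or_nonempty with h0 | h0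
  · rw [State.step_of_eq_empty _ _ _ _ h0, State.step_of_eq_empty _ _ _ _ h0]
  · rw [State.step_time _ _ _ _ h0] at h
    have h1 : st.newTotal ch (pathObservation u y') = st.newTotal ch (pathObservation u y) := by
      funext i
      unfold State.newTotal
      congr 1
      refine Finset.sum_congr rfl fun r hr => ?_
      simp only [State.recorded, Finset.mem_filter, Finset.mem_range] at hr
      rw [pathObservation, pathObservation, h _ _ (by omega)]
    have h2 : st.newLo ch δ (pathObservation u y') = st.newLo ch δ (pathObservation u y) := by
      funext i
      simp only [State.newLo, State.newMean, h1]
    have h3 : st.newHi ch δ (pathObservation u y') = st.newHi ch δ (pathObservation u y) := by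
      funext i
      simp only [State.newHi, State.newMean, h1]
    simp only [State.step, h1, h2, h3]

lemma State.time_le_step (st : State N) (x : Item N → Item N → ℕ → ℝ) :
    st.time ≤ (st.step ch δ x).time := by
  rcases st.unranked.eq_empty_or_nonempty with h0 | h0
  · rw [State.step_of_eq_empty _ _ _ _ h0]
  · rw [State.step_time _ _ _ _ h0]
    omega

lemma pathRun_congr {n : ℕ} {y y' : NoisePath N}
    (h : ∀ e, ∀ t < (pathRun u ch δ n y).time, y' e t = y e t) :
    pathRun u ch δ n y' = pathRun u ch δ n y := by
  induction n with
  | zero => rfl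
  | succ n ih =>
    rw [pathRun_succ] at h
    have h1 := ih fun e t ht => h e t (ht.trans_le (State.time_le_step _ _))
    rw [pathRun_succ, pathRun_succ, h1]
    exact State.step_congr _ h

end Dependence

section Exponential

variable (u : Item N → ℝ) (ch : Choices N) (δ : ℝ) (i : Item N) (lam a : ℝ)

/-- The sum of the noise variables recorded for item `i` in the first `n` iterations. -/
def noiseTotal : ℕ → NoisePath N → ℝ
  | 0, _ => 0
  | n + 1, y => noiseTotal n y + (pathRun u ch δ n y).noiseIncrement ch y i

/-- The exponential process of the noise recorded for item `i`. -/
def expProcess (n : ℕ) (y : NoisePath N) : ℝ :=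
  Real.exp (lam * noiseTotal u ch δ i n y - lam ^ 2 / 8 * (pathRun u ch δ n y).count i)

open Classical in
/-- The exponential process, stopped as soon as it reaches `a`. -/
def stoppedProcess : ℕ → NoisePath N → ℝ
  | 0, _ => 1
  | n + 1, y => stoppedProcess n y * Real.exp ((if a ≤ stoppedProcess n y then 0 else lam) *
      (pathRun u ch δ n y).noiseIncrement ch y i -
      (if a ≤ stoppedProcess n y then 0 else lam) ^ 2 / 8 *
        ((pathRun u ch δ n y).recorded ch i).card)

variable {u ch δ i lam a}

lemma stoppedProcess_nonneg (n : ℕ) (y : NoisePath N) :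
    0 ≤ stoppedProcess u ch δ i lam a n y := by
  induction n with
  | zero => exact zero_le_one
  | succ n ih => exact mul_nonneg ih (Real.exp_nonneg _)

lemma expProcess_succ (n : ℕ) (y : NoisePath N) : expProcess u ch δ i lam (n + 1) y =
    expProcess u ch δ i lam n y * Real.exp (lam * (pathRun u ch δ n y).noiseIncrement ch y i -
      lam ^ 2 / 8 * ((pathRun u ch δ n y).recorded ch i).card) := by
  rw [expProcess, expProcess, noiseTotal, pathRun_succ, State.step_count, State.newCount,
    ← Real.exp_add]
  congr 1
  push_cast
  ring

lemma stoppedProcess_eq_or_le (n : ℕ) (y : NoisePath N) :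
    stoppedProcess u ch δ i lam a n y = expProcess u ch δ i lam n y ∨
      a ≤ stoppedProcess u ch δ i lam a n y := by
  induction n with
  | zero => simp [stoppedProcess, expProcess, noiseTotal, pathRun, run, State.init]
  | succ n ih =>
    by_cases h : a ≤ stoppedProcess u ch δ i lam a n y
    · right
      simp [stoppedProcess, h]
    · left
      rw [stoppedProcess, if_neg h, ih.resolve_right h, expProcess_succ]

lemma monotone_le_stoppedProcess (y : NoisePath N) :
    Monotone fun n => a ≤ stoppedProcess u ch δ i lam a n y :=
  monotone_nat_of_le_succ fun n h => by
    change a ≤ stoppedProcess u ch δ i lam a n y at h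
    simp [stoppedProcess, h]

lemma stoppedProcess_congr {n : ℕ} {y y' : NoisePath N}
    (h : ∀ e, ∀ t < (pathRun u ch δ n y).time, y' e t = y e t) :
    stoppedProcess u ch δ i lam a n y' = stoppedProcess u ch δ i lam a n y := by
  induction n with
  | zero => rfl
  | succ n ih =>
    rw [pathRun_succ] at h
    have h0 : ∀ e, ∀ t < (pathRun u ch δ n y).time, y' e t = y e t :=
      fun e t ht => h e t (ht.trans_le (State.time_le_step _ _))
    rw [stoppedProcess, stoppedProcess, ih h0, pathRun_congr h0]
    rcases (pathRun u ch δ n y).unranked.eq_empty_or_nonempty with h1 | h1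
    · have h2 : (pathRun u ch δ n y).recorded ch i = ∅ :=
        State.recorded_eq_empty _ (by simp [h1])
      simp [State.noiseIncrement, h2]
    · rw [State.step_time _ _ _ _ h1] at h
      rw [State.noiseIncrement_congr _ h]

lemma measurable_stoppedProcess (n : ℕ) : Measurable (stoppedProcess u ch δ i lam a n) := by
  induction n with
  | zero => exact measurable_const
  | succ n ih =>
    refine ih.mul ?_
    have hite : Measurable fun y => if a ≤ stoppedProcess u ch δ i lam a n y then 0 else lam :=
      Measurable.ite (measurableSet_le measurable_const ih) measurable_const measurable_const
    have hinc : Measurable fun y => (pathRun u ch δ n y).noiseIncrement ch y i :=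
      measurable_of_countable_config (measurableState_pathRun (u := u) (ch := ch) (δ := δ) n).config
        (F := fun c y => (State.withConfig c (State.init N)).noiseIncrement ch y i)
        fun c => measurable_noiseIncrement _ i
    have hcard : Measurable fun y => (((pathRun u ch δ n y).recorded ch i).card : ℝ) :=
      measurable_of_countable_config (measurableState_pathRun (u := u) (ch := ch) (δ := δ) n).config
        (F := fun c _ => (((State.withConfig c (State.init N)).recorded ch i).card : ℝ))
        fun c => measurable_const
    fun_prop

end Exponential

end

noncomputable section

variable {N : ℕ}

/-- The realization `y` with all noise variables from time `t` on replaced by `0`. -/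
def NoisePath.truncate (t : ℕ) (y : NoisePath N) : NoisePath N := fun e s => if s < t then y e s else 0

section Noise

variable {Ω : Type w} [MeasurableSpace Ω] {μ : Measure Ω}
  {ε : Sym2 (Item N) → ℕ → Ω → ℝ}

lemma lintegral_exp_sub_le_one {X : Ω → ℝ} {c : ℝ≥0} (hX : HasSubgaussianMGF X c μ) (lam : ℝ)
    {b : ℝ} (hb : c * lam ^ 2 / 2 ≤ b) : ∫⁻ ω, ENNReal.ofReal (Real.exp (lam * X ω - b)) ∂μ ≤ 1 := by
  have h1 : Integrable (fun ω => Real.exp (lam * X ω - b)) μ := by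
    simp only [Real.exp_sub]
    exact (hX.integrable_exp_mul lam).div_const _
  rw [← ofReal_integral_eq_lintegral_ofReal h1 (Filter.Eventually.of_forall fun ω =>
    (Real.exp_nonneg _)), ENNReal.ofReal_le_one]
  simp only [Real.exp_sub]
  rw [integral_div, div_le_one (Real.exp_pos _)]
  exact (hX.mgf_le lam).trans (Real.exp_le_exp.2 hb)

lemma IsNoise.lintegral_mul_exp_le (hε : IsNoise μ ε) (t : ℕ) {G : NoisePath N → ℝ≥0∞}
    (hG : Measurable G) (hGt : ∀ y, G y = G (y.truncate t)) (R : Finset ℕ)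
    (e : ℕ → Sym2 (Item N)) (lam : ℝ) :
    ∫⁻ ω, G (fun e t => ε e t ω) * ENNReal.ofReal
      (Real.exp (lam * ∑ r ∈ R, ε (e r) (t + r) ω - lam ^ 2 / 8 * R.card)) ∂μ ≤
        ∫⁻ ω, G (fun e t => ε e t ω) ∂μ := by
  classical
  let A : Finset (Sym2 (Item N) × ℕ) := Finset.univ ×ˢ Finset.range t
  let B : Finset (Sym2 (Item N) × ℕ) := R.image fun r => (e r, t + r)
  have hinj : Set.InjOn (fun r => (e r, t + r)) (R : Set ℕ) := fun r _ r' _ h => by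
    simp only [Prod.mk.injEq] at h
    omega
  have hdisj : Disjoint A B := by
    rw [Finset.disjoint_left]
    intro p hp hp'
    obtain ⟨r, -, rfl⟩ := Finset.mem_image.1 hp'
    simp [A] at hp
  have hind := hε.indep.indepFun_finset A B hdisj fun p => hε.measurable p.1 p.2
  let φ : (A → ℝ) → NoisePath N := fun z e s =>
    if h : s < t then z ⟨(e, s), by simp [A, h]⟩ else 0
  have hφ : Measurable φ := by
    refine measurable_pi_lambda _ fun e => measurable_pi_lambda _ fun s => ?_
    by_cases h : s < t
    · simp only [φ, h, dif_pos]
      fun_prop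
    · simp only [φ, h, dif_neg, not_false_eq_true]
      fun_prop
  let ψ : (B → ℝ) → ℝ≥0∞ := fun z =>
    ENNReal.ofReal (Real.exp (lam * ∑ p, z p - lam ^ 2 / 8 * R.card))
  have hψ : Measurable ψ := by fun_prop
  have hAm : Measurable fun (ω : Ω) (p : A) => ε p.1.1 p.1.2 ω :=
    measurable_pi_lambda _ fun p => hε.measurable _ _
  have hBm : Measurable fun (ω : Ω) (p : B) => ε p.1.1 p.1.2 ω :=
    measurable_pi_lambda _ fun p => hε.measurable _ _
  have hind' := hind.comp (hG.comp hφ) hψ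
  have h1 : ∀ ω, G (fun e t => ε e t ω) = ((G ∘ φ) ∘ fun ω (p : A) => ε p.1.1 p.1.2 ω) ω := by
    intro ω
    rw [hGt]
    refine congrArg G ?_
    funext e s
    simp only [NoisePath.truncate, φ]
    split_ifs <;> rfl
  have hsum : ∀ ω, ∑ r ∈ R, ε (e r) (t + r) ω = ∑ p ∈ B, ε p.1 p.2 ω := fun ω =>
    (Finset.sum_image (f := fun p : Sym2 (Item N) × ℕ => ε p.1 p.2 ω) hinj).symm
  have h2 : ∀ ω, ENNReal.ofReal
      (Real.exp (lam * ∑ r ∈ R, ε (e r) (t + r) ω - lam ^ 2 / 8 * R.card)) =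
      (ψ ∘ fun ω (p : B) => ε p.1.1 p.1.2 ω) ω := by
    intro ω
    rw [hsum, ← Finset.sum_coe_sort B (fun p => ε p.1 p.2 ω)]
    rfl
  have hsub := HasSubgaussianMGF.sum_of_iIndepFun hε.indep (c := fun _ => (1 / 4 : ℝ≥0)) (s := B)
    fun p _ => hε.subgaussian p.1 p.2
  have h3 : ∫⁻ ω, (ψ ∘ fun ω (p : B) => ε p.1.1 p.1.2 ω) ω ∂μ ≤ 1 := by
    simp only [← h2, hsum]
    refine lintegral_exp_sub_le_one hsub lam ?_
    rw [Finset.sum_const, show B.card = R.card from Finset.card_image_of_injOn hinj]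
    rw [nsmul_eq_mul]
    push_cast
    linarith
  calc _ = ∫⁻ ω, (((G ∘ φ) ∘ fun ω (p : A) => ε p.1.1 p.1.2 ω) *
        (ψ ∘ fun ω (p : B) => ε p.1.1 p.1.2 ω)) ω ∂μ := by
        simp only [h1, h2, Pi.mul_apply]
    _ = (∫⁻ ω, ((G ∘ φ) ∘ fun ω (p : A) => ε p.1.1 p.1.2 ω) ω ∂μ) *
        ∫⁻ ω, (ψ ∘ fun ω (p : B) => ε p.1.1 p.1.2 ω) ω ∂μ :=
        lintegral_mul_eq_lintegral_mul_lintegral_of_indepFun ((hG.comp hφ).comp hAm)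
          (hψ.comp hBm) hind'
    _ ≤ (∫⁻ ω, ((G ∘ φ) ∘ fun ω (p : A) => ε p.1.1 p.1.2 ω) ω ∂μ) * 1 := by gcongr
    _ = _ := by rw [mul_one]; simp only [← h1]

lemma IsNoise.measurable_path (hε : IsNoise μ ε) :
    Measurable fun ω => (fun e t => ε e t ω : NoisePath N) :=
  measurable_pi_lambda _ fun e => measurable_pi_lambda _ fun t => hε.measurable e t

lemma lintegral_eq_tsum_of_countable {C : Type*} [Countable C] {D : Ω → C}
    (hD : ∀ c, MeasurableSet {ω | D ω = c}) {f : Ω → ℝ≥0∞} (hf : Measurable f) :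
    ∫⁻ ω, f ω ∂μ = ∑' c, ∫⁻ ω, {ω | D ω = c}.indicator f ω ∂μ := by
  classical
  rw [← lintegral_tsum fun c => (hf.indicator (hD c)).aemeasurable]
  refine lintegral_congr fun ω => ?_
  rw [tsum_eq_single (D ω) fun c hc => Set.indicator_of_notMem (by simpa using hc.symm) _]
  exact (Set.indicator_of_mem (show ω ∈ {ω' | D ω' = D ω} from rfl) f).symm

variable {u : Item N → ℝ} {ch : Choices N} {δ : ℝ} {i : Item N} {lam a : ℝ}

lemma IsNoise.lintegral_stoppedProcess_le_one [IsProbabilityMeasure μ] (hε : IsNoise μ ε) (n : ℕ) :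
    ∫⁻ ω, ENNReal.ofReal (stoppedProcess u ch δ i lam a n fun e t => ε e t ω) ∂μ ≤ 1 := by
  classical
  induction n with
  | zero => simp [stoppedProcess]
  | succ n ih =>
    refine le_trans ?_ ih
    have hη := hε.measurable_path
    let Z := stoppedProcess u ch δ i lam a n
    have hZ : Measurable Z := measurable_stoppedProcess n
    let D : NoisePath N → (ℕ × (Item N → ℕ) × (Item N → Finset (Item N))) × Prop := fun y =>
      ((pathRun u ch δ n y).config, a ≤ Z y)
    have hD : ∀ c, MeasurableSet {y | D y = c} := by
      intro c
      have h : {y | D y = c} = {y | (pathRun u ch δ n y).config = c.1} ∩ {y | (a ≤ Z y) ↔ c.2} := by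
        ext y
        exact Prod.ext_iff.trans (and_congr Iff.rfl eq_iff_iff)
      rw [h]
      refine ((measurableState_pathRun n).config c.1).inter ?_
      exact measurableSet_setOfPred.2 ((measurableSet_setOfPred.1
        (measurableSet_le measurable_const hZ)).iff measurable_const)
    have hDη : ∀ c, MeasurableSet {ω | D (fun e t => ε e t ω) = c} := fun c => hη (hD c)
    rw [lintegral_eq_tsum_of_countable hDη
        (f := fun ω => ENNReal.ofReal (stoppedProcess u ch δ i lam a (n + 1) fun e t => ε e t ω))
        ((measurable_stoppedProcess (n + 1)).comp hη).ennreal_ofReal,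
      lintegral_eq_tsum_of_countable hDη
        (f := fun ω => ENNReal.ofReal (stoppedProcess u ch δ i lam a n fun e t => ε e t ω))
        (hZ.comp hη).ennreal_ofReal]
    refine ENNReal.tsum_le_tsum fun c => ?_
    let G : NoisePath N → ℝ≥0∞ := {y | D y = c}.indicator fun y => ENNReal.ofReal (Z y)
    have hG : Measurable G := hZ.ennreal_ofReal.indicator (hD c)
    let σ : State N := State.withConfig c.1 (State.init N)
    have hGt : ∀ y, G y = G (y.truncate c.1.1) := by
      intro y
      have hagree : ∀ e, ∀ t < c.1.1, (y.truncate c.1.1) e t = y e t := fun e t ht => if_pos ht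
      by_cases h : (pathRun u ch δ n y).time = c.1.1 ∨
          (pathRun u ch δ n (y.truncate c.1.1)).time = c.1.1
      · have h1 : pathRun u ch δ n (y.truncate c.1.1) = pathRun u ch δ n y ∧
            Z (y.truncate c.1.1) = Z y := by
          rcases h with h | h
          · exact ⟨pathRun_congr (h ▸ hagree), stoppedProcess_congr (h ▸ hagree)⟩
          · have h2 : ∀ e, ∀ t < (pathRun u ch δ n (y.truncate c.1.1)).time,
                y e t = (y.truncate c.1.1) e t := fun e t ht => (hagree e t (h ▸ ht)).symm
            exact ⟨(pathRun_congr h2).symm, (stoppedProcess_congr h2).symm⟩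
        have h3 : D (y.truncate c.1.1) = D y := by simp only [D, h1.1, h1.2]
        simp only [G, Set.indicator, Set.mem_ofPred_eq, h3, h1.2]
        split_ifs <;> rfl
      · push Not at h
        have h1 : ∀ y', (pathRun u ch δ n y').time ≠ c.1.1 → G y' = 0 := fun y' hy' =>
          Set.indicator_of_notMem (show y' ∉ {y | D y = c} from
            fun h' : D y' = c => hy' (by rw [← h']; rfl)) _
        rw [h1 _ h.1, h1 _ h.2]
    have key := hε.lintegral_mul_exp_le c.1.1 hG hGt (σ.recorded ch i)
      (fun r => s(i, σ.partner ch r i)) (if c.2 then 0 else lam)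
    refine le_of_eq_of_le (lintegral_congr fun ω => ?_) (key.trans_eq (lintegral_congr fun ω => ?_))
    · by_cases h : D (fun e t => ε e t ω) = c
      · rw [Set.indicator_of_mem (show ω ∈ {ω | D (fun e t => ε e t ω) = c} from h),
          show G (fun e t => ε e t ω) = ENNReal.ofReal (Z fun e t => ε e t ω) from
            Set.indicator_of_mem (show _ ∈ {y | D y = c} from h) _, ← ENNReal.ofReal_mul (stoppedProcess_nonneg n _)]
        subst h
        rfl
      · rw [Set.indicator_of_notMem (show ω ∉ {ω | D (fun e t => ε e t ω) = c} from h),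
          show G (fun e t => ε e t ω) = 0 from
            Set.indicator_of_notMem (show _ ∉ {y | D y = c} from h) _, zero_mul]
    · rfl

lemma IsNoise.measure_exists_le_expProcess_le [IsProbabilityMeasure μ] (hε : IsNoise μ ε) (ha : 0 < a) :
    μ {ω | ∃ n, a ≤ expProcess u ch δ i lam n fun e t => ε e t ω} ≤ ENNReal.ofReal (1 / a) := by
  have hsub : {ω | ∃ n, a ≤ expProcess u ch δ i lam n fun e t => ε e t ω} ⊆
      ⋃ n, {ω | a ≤ stoppedProcess u ch δ i lam a n fun e t => ε e t ω} := by
    rintro ω ⟨n, hn⟩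
    refine Set.mem_iUnion.2 ⟨n, ?_⟩
    rcases stoppedProcess_eq_or_le (u := u) (ch := ch) (δ := δ) (i := i) (lam := lam) (a := a) n
      (fun e t => ε e t ω) with h | h
    · exact hn.trans_eq h.symm
    · exact h
  refine (measure_mono hsub).trans ?_
  have hmono : Monotone fun n =>
      {ω | a ≤ stoppedProcess u ch δ i lam a n fun e t => ε e t ω} :=
    fun m n hmn ω hω => monotone_le_stoppedProcess _ hmn hω
  rw [hmono.measure_iUnion]
  refine iSup_le fun n => ?_
  have h1 := mul_meas_ge_le_lintegral (μ := μ) (f := fun ω =>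
    ENNReal.ofReal (stoppedProcess u ch δ i lam a n fun e t => ε e t ω))
    ((measurable_stoppedProcess n).comp hε.measurable_path).ennreal_ofReal (ENNReal.ofReal a)
  have h2 := h1.trans (hε.lintegral_stoppedProcess_le_one n)
  simp only [ENNReal.ofReal_le_ofReal_iff (stoppedProcess_nonneg _ _)] at h2
  rw [one_div, ENNReal.ofReal_inv_of_pos ha, ENNReal.le_inv_iff_mul_le, mul_comm]
  exact h2

end Noise

end

noncomputable section

variable {N : ℕ} {u : Item N → ℝ} {ch : Choices N} {δ : ℝ}

lemma total_sub_meanTotal (n : ℕ) (y : NoisePath N) (i : Item N) :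
    (pathRun u ch δ n y).total i - meanTotal u ch δ (pathObservation u y) n i =
      noiseTotal u ch δ i n y := by
  induction n with
  | zero => simp [pathRun, run, State.init, meanTotal, noiseTotal]
  | succ n ih =>
    rw [pathRun_succ, State.step_total, State.newTotal, meanTotal, noiseTotal, ← ih,
      State.noiseIncrement]
    simp only [pathObservation, Finset.sum_add_distrib]
    simp only [pathRun]
    ring

/-- The half-width of the confidence intervals of level `l`. -/
def width (N : ℕ) (δ : ℝ) (l : ℕ) : ℝ :=
  Real.sqrt (Real.log (beta N δ l) / (kLevel N δ l : ℝ))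

lemma exists_sq_beta_le_expProcess (hN : 2 ≤ N) (hδ : 0 < δ) (hδ1 : δ < 1) {y : NoisePath N}
    (h : ¬ Concentrates u ch δ (pathObservation u y)) : ∃ i l, 1 ≤ l ∧
      ((∃ n, beta N δ l ^ 2 ≤ expProcess u ch δ i (4 * width N δ l) n y) ∨
        ∃ n, beta N δ l ^ 2 ≤ expProcess u ch δ i (-(4 * width N δ l)) n y) := by
  simp only [Concentrates, not_forall, not_le] at h
  obtain ⟨n, i, hup, hlt⟩ := h
  set st := run ch δ (pathObservation u y) n with hst
  set l := epoch N δ (st.newCount ch i) with hl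
  have hl1 : 1 ≤ l := Nat.succ_le_of_lt ((Nat.zero_le _).trans_lt hup)
  have hk : kLevel N δ l ≤ st.newCount ch i := kLevel_epoch_le (by omega)
  have hw : st.newWidth ch δ i = width N δ l := rfl
  have hcount : (pathRun u ch δ (n + 1) y).count i = st.newCount ch i := by
    rw [pathRun_succ, State.step_count]
    rfl
  have hnoise : st.newTotal ch (pathObservation u y) i -
      meanTotal u ch δ (pathObservation u y) (n + 1) i = noiseTotal u ch δ i (n + 1) y := by
    rw [← total_sub_meanTotal, pathRun_succ, State.step_total]
    rfl
  rw [hnoise, hw] at hlt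
  have hβ := three_mul_le_beta hN hδ hδ1 l
  have hl1' : (1 : ℝ) ≤ l := by exact_mod_cast hl1
  have hlog := one_le_log_beta hN hδ hδ1 hl1
  have hkpos : (0 : ℝ) < kLevel N δ l := by
    exact_mod_cast hl1.trans (self_le_kLevel hN hδ hδ1 l)
  have hw0 : 0 ≤ width N δ l := Real.sqrt_nonneg _
  have hw2 : width N δ l ^ 2 * kLevel N δ l = Real.log (beta N δ l) := by
    rw [width, Real.sq_sqrt (by positivity), div_mul_cancel₀ _ hkpos.ne']
  have hk' : (kLevel N δ l : ℝ) ≤ st.newCount ch i := by exact_mod_cast hk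
  have h1 : Real.log (beta N δ l) ≤ width N δ l ^ 2 * st.newCount ch i := by
    rw [← hw2]
    gcongr
  have h2 : beta N δ l ^ 2 = Real.exp (2 * Real.log (beta N δ l)) := by
    rw [two_mul, Real.exp_add, Real.exp_log (by linarith), sq]
  refine ⟨i, l, hl1, ?_⟩
  rcases lt_abs.1 hlt with h3 | h3
  · refine Or.inl ⟨n + 1, ?_⟩
    rw [h2, expProcess, Real.exp_le_exp, hcount]
    have := mul_le_mul_of_nonneg_left h3.le hw0
    nlinarith
  · refine Or.inr ⟨n + 1, ?_⟩
    rw [h2, expProcess, Real.exp_le_exp, hcount]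
    have := mul_le_mul_of_nonneg_left h3.le hw0
    nlinarith

lemma hasSum_two_div_sq_beta (hN : 2 ≤ N) (hδ : 0 < δ) :
    HasSum (fun l => 2 * (1 / beta N δ l ^ 2)) (δ / (2 * N)) := by
  have hN' : (0 : ℝ) < N := by exact_mod_cast (by omega : 0 < N)
  have hpi := Real.pi_pos
  have h := hasSum_zeta_two.mul_left (3 * δ / (Real.pi ^ 2 * N))
  have h1 : 3 * δ / (Real.pi ^ 2 * N) * (Real.pi ^ 2 / 6) = δ / (2 * N) := by
    field_simp
    norm_num
  rw [h1] at h
  refine h.congr_fun ?_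
  intro l
  rw [beta, mul_pow, mul_pow, Real.sq_sqrt (by positivity)]
  rcases Nat.eq_zero_or_pos l with rfl | hl
  · simp
  · have hl' : (0 : ℝ) < l := by exact_mod_cast hl
    field_simp

lemma IsNoise.measure_not_concentrates_le {Ω : Type w} [MeasurableSpace Ω] {μ : Measure Ω}
    [IsProbabilityMeasure μ] {ε : Sym2 (Item N) → ℕ → Ω → ℝ} (hε : IsNoise μ ε) (hN : 2 ≤ N)
    (hδ : 0 < δ) (hδ1 : δ < 1) :
    μ {ω | ¬ Concentrates u ch δ (observation u ε ω)} ≤ ENNReal.ofReal δ := by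
  let E : Item N → ℝ → ℕ → Set Ω := fun i lam l =>
    {ω | 1 ≤ l ∧ ∃ n, beta N δ l ^ 2 ≤ expProcess u ch δ i lam n fun e t => ε e t ω}
  have hE : ∀ i lam l, μ (E i lam l) ≤ ENNReal.ofReal (1 / beta N δ l ^ 2) := by
    intro i lam l
    by_cases hl : 1 ≤ l
    · have hβ := three_mul_le_beta hN hδ hδ1 l
      have hl1' : (1 : ℝ) ≤ l := by exact_mod_cast hl
      refine (measure_mono fun ω hω => ?_).trans (hε.measure_exists_le_expProcess_le (u := u)
        (ch := ch) (δ := δ) (i := i) (lam := lam) (pow_pos (by linarith : 0 < beta N δ l) 2))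
      exact hω.2
    · have : E i lam l = ∅ := Set.eq_empty_of_forall_notMem fun ω hω => hl hω.1
      rw [this, measure_empty]
      exact zero_le
  have hsub : {ω | ¬ Concentrates u ch δ (observation u ε ω)} ⊆
      ⋃ i, ⋃ l, E i (4 * width N δ l) l ∪ E i (-(4 * width N δ l)) l := by
    intro ω hω
    obtain ⟨i, l, hl, h⟩ := exists_sq_beta_le_expProcess (y := fun e t => ε e t ω) hN hδ hδ1 hω
    refine Set.mem_iUnion.2 ⟨i, Set.mem_iUnion.2 ⟨l, ?_⟩⟩
    rcases h with h | h
    · exact Or.inl ⟨hl, h⟩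
    · exact Or.inr ⟨hl, h⟩
  have hsum := hasSum_two_div_sq_beta hN hδ
  have hN' : (0 : ℝ) < N := by exact_mod_cast (by omega : 0 < N)
  calc _ ≤ μ (⋃ i, ⋃ l, E i (4 * width N δ l) l ∪ E i (-(4 * width N δ l)) l) := measure_mono hsub
    _ ≤ ∑ i, μ (⋃ l, E i (4 * width N δ l) l ∪ E i (-(4 * width N δ l)) l) :=
        measure_iUnion_fintype_le _ _
    _ ≤ ∑ i : Item N, ENNReal.ofReal (δ / (2 * N)) := by
        refine Finset.sum_le_sum fun i _ => ?_
        refine (measure_iUnion_le _).trans ?_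
        rw [← hsum.tsum_eq, ENNReal.ofReal_tsum_of_nonneg (fun l => by positivity) hsum.summable]
        refine ENNReal.tsum_le_tsum fun l => ?_
        rw [ENNReal.ofReal_mul zero_le_two, ENNReal.ofReal_ofNat, two_mul]
        exact (measure_union_le _ _).trans (add_le_add (hE _ _ _) (hE _ _ _))
    _ = ENNReal.ofReal δ := by
        rw [Finset.sum_const, Finset.card_univ, Fintype.card_fin, ← ENNReal.ofReal_nsmul,
          nsmul_eq_mul]
        congr 1
        push_cast
        field_simp

lemma sampleComplexityLE_of_concentrates (hN : 2 ≤ N) {b : ℝ → ℝ}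
    (h : ∀ δ, 0 < δ → δ < 1 → ∀ (ch : Choices N) (x : Item N → Item N → ℕ → ℝ),
      Concentrates u ch δ x → IdentifiesWithin u ch δ x (b δ)) : SampleComplexityLE.{w} u b := by
  intro δ hδ ch Ω _ μ _ ε hε
  rcases lt_or_ge δ 1 with hδ1 | hδ1
  · have h1 : (Set.univ : Set Ω) ⊆ {ω | IdentifiesWithin u ch δ (observation u ε ω) (b δ)} ∪
        {ω | ¬ Concentrates u ch δ (observation u ε ω)} := by
      intro ω _
      by_cases hc : Concentrates u ch δ (observation u ε ω)
      · exact Or.inl (h δ hδ hδ1 ch _ hc)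
      · exact Or.inr hc
    have h2 := (measure_mono h1).trans (measure_union_le (μ := μ) _ _)
    rw [measure_univ] at h2
    have h3 := h2.trans (add_le_add le_rfl (hε.measure_not_concentrates_le hN hδ hδ1))
    rw [ENNReal.ofReal_sub _ hδ.le, ENNReal.ofReal_one]
    exact tsub_le_iff_right.2 h3
  · rw [ENNReal.ofReal_of_nonpos (by linarith)]
    exact zero_le

end

lemma IdentifiesWithin.mono {N : ℕ} {u : Item N → ℝ} {ch : Choices N} {δ : ℝ}
    {x : Item N → Item N → ℕ → ℝ} {b b' : ℝ} (h : IdentifiesWithin u ch δ x b) (hb : b ≤ b') :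
    IdentifiesWithin u ch δ x b' := by
  obtain ⟨n, h1, h2, h3⟩ := h
  exact ⟨n, h1, h2.trans hb, h3⟩

section Bounds

variable {N : ℕ} {u : Item N → ℝ}

lemma exists_sampleComplexityLE (hN : 2 ≤ N) {L : ℕ} (hL : 1 ≤ L) {C : ℝ}
    (hC : 8 * (2 ^ L) ^ 2 ≤ C)
    (h : ∀ δ, 0 < δ → δ < 1 → ∀ (ch : Choices N) (x : Item N → Item N → ℕ → ℝ),
      Concentrates u ch δ x → IdentifiesWithin u ch δ x (4 * kLevel N δ L + 2 * N)) :
    ∃ cp : ℝ, SampleComplexityLE.{w} u fun δ => C * Real.log (1 / δ) + cp := by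
  refine ⟨16 * (2 ^ L) ^ 2 * Real.log (Real.pi * Real.sqrt (2 * (N : ℝ) / 3) * L) + 4 + 2 * N,
    sampleComplexityLE_of_concentrates hN fun δ hδ hδ1 ch x hc =>
    (h δ hδ hδ1 ch x hc).mono ((four_mul_kLevel_add_le hN hδ hδ1 hL).trans ?_)⟩
  have hlog : 0 ≤ Real.log (1 / δ) := Real.log_nonneg (by rw [le_div_iff₀ hδ]; linarith)
  exact add_le_add (mul_le_mul_of_nonneg_right hC hlog) le_rfl

variable (hN : 2 ≤ N) (h01 : ∀ i, 0 < u i ∧ u i < 1) (hu : Antitone u)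
  (hgap : ∀ k, 0 < gap u k)
include hN h01 hu hgap

lemma exists_sampleComplexityLE_gammaMin : ∃ cp : ℝ, SampleComplexityLE.{w} u fun δ =>
    2 ^ 17 * (1 / gammaMin u ^ 2) * Real.log (1 / δ) + cp := by
  have hne : Nonempty (Fin (N - 1)) := ⟨⟨0, by omega⟩⟩
  obtain ⟨k₀, hk₀⟩ := exists_eq_ciInf_of_finite (f := fun k => muWithout u k * gap u k)
  have hγ : gammaMin u = muWithout u k₀ * gap u k₀ := hk₀.symm
  have hγ0 : 0 < gammaMin u := hγ ▸ mul_pos (muWithout_pos (fun i => (h01 i).1) k₀) (hgap k₀)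
  have hγ1 : gammaMin u ≤ 1 := hγ ▸ muWithout_mul_gap_le_one h01 hgap k₀
  have hγk : ∀ k, gammaMin u ≤ muWithout u k * gap u k := fun k =>
    ciInf_le (Set.finite_range _).bddBelow k
  obtain ⟨L, hL, h1, h2⟩ := exists_pow_two_near (r := 4 / gammaMin u)
    (by rw [le_div_iff₀ hγ0]; linarith)
  rw [div_lt_iff₀ hγ0] at h1
  refine exists_sampleComplexityLE hN hL ?_ fun δ hδ hδ1 ch x hc =>
    identifiesWithin_of_four_lt hN hδ hδ1 h01 hu hgap hc hL fun k => ?_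
  · calc (8 : ℝ) * (2 ^ L) ^ 2 ≤ 8 * (2 * (4 / gammaMin u)) ^ 2 := by gcongr
      _ = 2 ^ 9 * (1 / gammaMin u ^ 2) := by field_simp; norm_num
      _ ≤ 2 ^ 17 * (1 / gammaMin u ^ 2) := by gcongr <;> norm_num
  · have := mul_le_mul_of_nonneg_right (hγk k) (by positivity : (0 : ℝ) ≤ 2 ^ L)
    linarith

lemma exists_sampleComplexityLE_alpha (hp0 : 0 < 2 * N) (hp1 : 1 < 2 * N) {u₁ u₂ α : ℝ}
    {s h : Fin (N - 1)} (h₁ : u₁ = u ⟨0, hp0⟩) (h₂ : u₂ = u ⟨1, hp1⟩) (hs1 : 1 ≤ (s : ℕ))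
    (hs : ∀ k, gap u s ≤ gap u k)
    (hh : ∀ k, k ≠ s → muWithout u h * gap u h ≤ muWithout u k * gap u k)
    (hα : α = alpha u u₁ u₂ s h) (hα1 : α < 1) : ∃ cp : ℝ, SampleComplexityLE.{w} u fun δ =>
      2 ^ 17 * (1 / ((1 - α) ^ 2 * (u₁ ^ 2 + u₂ ^ 2) * gap u s ^ 2)) * Real.log (1 / δ) + cp := by
  have hu1 := h01 ⟨0, hp0⟩
  have hu2 := h01 ⟨1, hp1⟩
  rw [← h₁] at hu1
  rw [← h₂] at hu2
  have hgs := hgap s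
  have hgs1 : gap u s < 1 := by
    have := (h01 (upperItem s)).2
    have := (h01 (lowerItem s)).1
    unfold gap
    linarith
  set q := (u₁ + u₂) * gap u s with hq
  have hq0 : 0 < q := mul_pos (by linarith) hgs
  have hq2 : q ≤ 2 := by nlinarith
  have hG : 0 < muWithout u h * gap u h :=
    mul_pos (muWithout_pos (fun i => (h01 i).1) h) (hgap h)
  have hα0 : 0 ≤ α := by
    rw [hα, alpha]
    exact le_min (by positivity) zero_le_one
  have hqG : q / 2 ≤ muWithout u h * gap u h := by
    have h1 : 1 / 2 * (q / (muWithout u h * gap u h)) < 1 := by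
      rw [hα, alpha] at hα1
      exact (min_lt_iff.1 hα1).resolve_right (lt_irrefl _)
    rw [← mul_div_assoc, div_lt_one hG] at h1
    linarith
  obtain ⟨L, hL, h1, h2⟩ := exists_pow_two_near (r := 8 / q)
    (by rw [le_div_iff₀ hq0]; linarith)
  rw [div_lt_iff₀ hq0] at h1
  refine exists_sampleComplexityLE hN (L := L + 3) (by omega) ?_ fun δ hδ hδ1 ch x hc =>
    identifiesWithin_of_eight_lt hN hδ hδ1 h01 hu hgap hc hp0 hp1 hs1 hs (q := q)
      (by rw [hq, h₁, h₂]) (fun k hk => hqG.trans (hh k hk)) hL (by linarith)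
  have hden : 0 < (1 - α) ^ 2 * (u₁ ^ 2 + u₂ ^ 2) * gap u s ^ 2 := by
    have : 0 < 1 - α := by linarith
    have := hu1.1
    have := hu2.1
    positivity
  have hden' : (1 - α) ^ 2 * (u₁ ^ 2 + u₂ ^ 2) * gap u s ^ 2 ≤ q ^ 2 := by
    rw [hq, mul_pow]
    refine mul_le_mul_of_nonneg_right ?_ (sq_nonneg _)
    have h3 : (1 - α) ^ 2 ≤ 1 := pow_le_one₀ (by linarith) (by linarith)
    have h4 : u₁ ^ 2 + u₂ ^ 2 ≤ (u₁ + u₂) ^ 2 := by nlinarith [mul_pos hu1.1 hu2.1]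
    calc (1 - α) ^ 2 * (u₁ ^ 2 + u₂ ^ 2) ≤ 1 * (u₁ ^ 2 + u₂ ^ 2) := by gcongr
      _ ≤ _ := by rw [one_mul]; exact h4
  calc (8 : ℝ) * (2 ^ (L + 3)) ^ 2 = 2 ^ 9 * (2 ^ L) ^ 2 := by ring
    _ ≤ 2 ^ 9 * (2 * (8 / q)) ^ 2 := by gcongr
    _ = 2 ^ 17 * (1 / q ^ 2) := by field_simp; norm_num
    _ ≤ _ := by gcongr

end Bounds

end MatchingId

theorem theorem6 :
    ∃ c : ℝ, 0 < c ∧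
      ∀ (N : ℕ) (hN : 2 ≤ N) (u : MatchingId.Item N → ℝ),
        (∀ i, 0 < u i ∧ u i < 1) → Antitone u → (∀ k, 0 < MatchingId.gap u k) →
        (∃ cp : ℝ, MatchingId.SampleComplexityLE.{w} u
          (fun δ => c * (1 / MatchingId.gammaMin u ^ 2) * Real.log (1 / δ) + cp)) ∧
        ∀ (u₁ u₂ α : ℝ) (s h : Fin (N - 1)),
          u₁ = u ⟨0, by omega⟩ → u₂ = u ⟨1, by omega⟩ →
          1 ≤ (s : ℕ) → (∀ k, MatchingId.gap u s ≤ MatchingId.gap u k) →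
          h ≠ s → (∀ k, k ≠ s → MatchingId.muWithout u h * MatchingId.gap u h ≤
            MatchingId.muWithout u k * MatchingId.gap u k) →
          α = MatchingId.alpha u u₁ u₂ s h → α < 1 →
          ∃ cp : ℝ, MatchingId.SampleComplexityLE.{w} u
            (fun δ => c * (1 / ((1 - α) ^ 2 * (u₁ ^ 2 + u₂ ^ 2) * MatchingId.gap u s ^ 2)) *
              Real.log (1 / δ) + cp) := by
  refine ⟨2 ^ 17, by norm_num, fun N hN u h01 hu hgap =>
    ⟨MatchingId.exists_sampleComplexityLE_gammaMin hN h01 hu hgap, ?_⟩⟩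
  intro u₁ u₂ α s h h₁ h₂ hs1 hs _ hh hα hα1
  exact MatchingId.exists_sampleComplexityLE_alpha hN h01 hu hgap (by omega) (by omega) h₁ h₂ hs1 hs hh hα hα1
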